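/- All graphs are finite, simple and undirected. The Q-graph $\mathcal{Q}(G)$ of a graph $G$ is obtained from $G$ by inserting a new vertex into each edge of $G$ (so that each edge $uv$ is replaced by a path of length two from $u$ to $v$ through its new vertex) and joining by edges those pairs of new vertices that lie on adjacent edges of $G$ (distinct edges with a common end-vertex). For a graph $H$ with Laplacian matrix $L_H=D_H-A_H$, put $U_H(t)=\exp(-\mathrm{i}tL_H)$ for $t\in\mathbb{R}$. For two different vertices $a,b$ of $H$, the pair state of $\{a,b\}$ is the vector $\mathbf e_a-\mathbf e_b$, where $\mathbf e_v$ is the characteristic vector of $v$; pair states are considered up to sign, so the pair states $\mathbf e_a-\mathbf e_b$ and $\mathbf e_c-\mathbf e_d$ are distinct when $\{a,b\}\neq\{c,d\}$. The graph $H$ has Laplacian perfect pair state transfer between distinct pair states $\mathbf e_a-\mathbf e_b$ and $\mathbf e_c-\mathbf e_d$ if there are $\tau\in\mathbb{R}$ and $\chi\in\mathbb{C}$ with $|\chi|=1$ such that $U_H(\tau)(\mathbf e_a-\mathbf e_b)=\chi(\mathbf e_c-\mathbf e_d)$. Theorem. Let $r\ge 2$ be an integer and let $G$ be a connected $r$-regular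 graph. If $r+1$ is prime, then $\mathcal{Q}(G)$ does not have Laplacian perfect pair state transfer between any two distinct pair states. -/

import Mathlib

open scoped Matrix

/-- Adjacency in the Q-graph: two original vertices are never adjacent (each edge of `G` is
subdivided), an original vertex is adjacent to the new vertices of the edges containing it, and two
distinct new vertices are adjacent when their edges share an end-vertex. -/
def QAdj {V : Type*} (G : SimpleGraph V) : V ⊕ G.edgeSet → V ⊕ G.edgeSet → Prop
  | Sum.inl _, Sum.inl _ => False
  | Sum.inl u, Sum.inr e => u ∈ (e : Sym2 V)
  | Sum.inr e, Sum.inl u => u ∈ (e : Sym2 V)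
  | Sum.inr e, Sum.inr f => e ≠ f ∧ ∃ v : V, v ∈ (e : Sym2 V) ∧ v ∈ (f : Sym2 V)

/-- The Q-graph of `G`: `Sum.inl` gives the original vertices `V(G)`, `Sum.inr` the inserted
vertices `I(G)`, one for each edge of `G`. -/
def qGraph {V : Type*} (G : SimpleGraph V) : SimpleGraph (V ⊕ G.edgeSet) where
  Adj := QAdj G
  symm := by
    constructor
    rintro (u | e) (v | f) h
    · exact h
    · exact h
    · exact h
    · exact ⟨h.1.symm, h.2.imp fun _ hv => hv.symm⟩
  loopless := by
    constructor
    rintro (u | e) h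
    · exact h
    · exact h.1 rfl

instance {V : Type*} [Fintype V] [DecidableEq V] (G : SimpleGraph V) :
    DecidableRel (qGraph G).Adj
  | Sum.inl _, Sum.inl _ => isFalse id
  | Sum.inl u, Sum.inr e => inferInstanceAs (Decidable (u ∈ (e : Sym2 V)))
  | Sum.inr e, Sum.inl u => inferInstanceAs (Decidable (u ∈ (e : Sym2 V)))
  | Sum.inr e, Sum.inr f =>
    inferInstanceAs (Decidable (e ≠ f ∧ ∃ v : V, v ∈ (e : Sym2 V) ∧ v ∈ (f : Sym2 V)))

/-- The transition matrix `exp (-i t L)` of a finite graph relative to its Laplacian `L = D - A`. -/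
noncomputable def transitionMatrix {W : Type*} [Fintype W] [DecidableEq W] (H : SimpleGraph W)
    [DecidableRel H.Adj] (t : ℝ) : Matrix W W ℂ :=
  NormedSpace.exp ((-(Complex.I * (t : ℂ))) • H.lapMatrix ℂ)

/-- The vector `e_a - e_b`; it is a pair state when `a ≠ b`. -/
def pairState {W : Type*} [DecidableEq W] (a b : W) : W → ℂ :=
  Pi.single a 1 - Pi.single b 1

/-- `H` has Laplacian perfect pair state transfer between `e_a - e_b` and `e_c - e_d` at some
time. -/
def HasPairLPSTBetween {W : Type*} [Fintype W] [DecidableEq W] (H : SimpleGraph W)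
    [DecidableRel H.Adj] (a b c d : W) : Prop :=
  ∃ (τ : ℝ) (χ : ℂ), ‖χ‖ = 1 ∧
    transitionMatrix H τ *ᵥ pairState a b = χ • pairState c d

/-!
# No perfect pair state transfer in Q-graphs of `r`-regular graphs with `r + 1` prime

Write `p = r + 1`, and shift the Laplacian matrix `L` of the Q-graph to `N = p I - L`. In block form
`N = [[I, B], [Bᵀ, Bᵀ B - p I]]`, where `B` is the incidence matrix of `G` (`qMatR_eq_fromBlocks`).
An eigenvalue `α` of `G` gives the two eigenvalues `ζ` of `N` with `ζ ^ 2 = α ζ + p`, and besides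
them only `-p` occurs. The two roots have product `-p`. So, `ζ` and `p / ζ = ζ - α` being algebraic
integers, a *rational* eigenvalue of `N` divides the prime `p`, and then `α = ± r`
(`rational_eigenvalue`).

Suppose that there is a transfer from `x` to `y ≠ ± x` at time `τ`; then `τ ≠ 0`. For every eigenvector `z` of `N`
the numbers `⟨z, x⟩` and `⟨z, y⟩` agree up to a sign that depends only on the eigenvalue, and the
eigenvalues in the support of `x` lie in an arithmetic progression with difference `π / τ`
(`HasPairLPSTBetween.exists_sign`). The support is the set of roots of a polynomial with rational
coefficients (`exists_rat_coeff_prod_support`), so the sum of its elements and the sum of the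
squares of their differences are rational. Hence all its elements have the form `μ + q s`, with `μ` and `q`
rational and `s ^ 2` rational, and conjugates stay in the support (`exists_support_form`).

If the support is rational, then only the eigenvalues `± r` of `G` contribute, which is refuted by
looking at one entry of a matrix-vector product. Otherwise there are two cases.

* Both vertices of the pair are original, or both are inserted. Then the support contains with an
  irrational `ζ` also `-p / ζ`, and primality of `p` forces these two to be conjugate, with sum
  `α = 2 μ` (`sq_eq_of_partner`). By rationality of `x` and `y`, the signs at conjugate eigenvalues
  agree. Therefore `y` is, up to sign, `x` plus an eigenvector for the eigenvalue `μ`, and such an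
  eigenvector has too many nonzero entries (`false_of_irrational_of_partner`).
* One vertex is original, say `a`, and one is inserted. Then `-1` lies in the support, so `μ = -1`,
  and the bound `|α| ≤ r` for both conjugates forces `α = -2` (`sq_eq_of_conj`). So the
  characteristic vector of `a` is a combination of eigenvectors of `G` for `r` and `-2`, which is
  impossible, as the diagonal entries of `(A - r) (A + 2)` are negative.
-/

/-! ### Eigenvalue support of a vector -/

/-- The eigenvalue `θ` of the real symmetric matrix `N` lies in the eigenvalue support of `x`:
the projection of `x` to the `θ`-eigenspace is nonzero. This is encoded by an eigenvector that is
not orthogonal to `x`, so that no projection has to be formed. -/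
def InSupport {W : Type*} [Fintype W] (N : Matrix W W ℝ) (x : W → ℝ) (θ : ℝ) : Prop :=
  ∃ v : W → ℝ, N *ᵥ v = θ • v ∧ v ⬝ᵥ x ≠ 0

section Support

variable {W : Type*} [Fintype W]

theorem dotProduct_mulVec_of_eigenvector {N : Matrix W W ℝ} (hN : N.IsSymm) {v : W → ℝ} {θ : ℝ}
    (hv : N *ᵥ v = θ • v) (z : W → ℝ) : v ⬝ᵥ (N *ᵥ z) = θ * (v ⬝ᵥ z) := by
  rw [Matrix.dotProduct_mulVec, ← Matrix.mulVec_transpose, hN.eq, hv, smul_dotProduct, smul_eq_mul]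

theorem finite_inSupport (N : Matrix W W ℝ) (x : W → ℝ) : {θ | InSupport N x θ}.Finite := by
  apply (Module.End.finite_hasEigenvalue (N.mulVecLin)).subset
  rintro θ ⟨v, hv, hvx⟩
  apply Module.End.hasEigenvalue_of_hasEigenvector (x := v)
  rw [Module.End.hasEigenvector_iff, Module.End.mem_eigenspace_iff]
  refine ⟨by simpa using hv, ?_⟩
  rintro rfl
  simp at hvx

variable [DecidableEq W]

theorem dotProduct_aeval_mulVec_of_eigenvector {N : Matrix W W ℝ} (hN : N.IsSymm) {v : W → ℝ}
    {θ : ℝ} (hv : N *ᵥ v = θ • v) (P : Polynomial ℝ) (z : W → ℝ) :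
    v ⬝ᵥ ((Polynomial.aeval N P) *ᵥ z) = P.eval θ * (v ⬝ᵥ z) := by
  induction P using Polynomial.induction_on' with
  | add p q hp hq => simp [Matrix.add_mulVec, dotProduct_add, hp, hq, add_mul]
  | monomial n a =>
    have hpow : ∀ k : ℕ, v ⬝ᵥ ((N ^ k) *ᵥ z) = θ ^ k * (v ⬝ᵥ z) := by
      intro k
      induction k with
      | zero => simp
      | succ k ih =>
        rw [pow_succ', ← Matrix.mulVec_mulVec, dotProduct_mulVec_of_eigenvector hN hv, ih,
          pow_succ']
        ring
    rw [Polynomial.aeval_monomial, ← Algebra.smul_def, Matrix.smul_mulVec, dotProduct_smul, hpow]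
    simp [mul_assoc]

/-- A vector orthogonal to all eigenvectors of a real symmetric matrix vanishes. -/
theorem eq_zero_of_forall_eigenvector {N : Matrix W W ℝ} (hN : N.IsSymm) {z : W → ℝ}
    (h : ∀ (θ : ℝ) (v : W → ℝ), N *ᵥ v = θ • v → v ⬝ᵥ z = 0) : z = 0 := by
  have hH : N.IsHermitian := by
    rw [Matrix.IsHermitian, Matrix.conjTranspose_eq_transpose_of_trivial, hN.eq]
  have h0 : WithLp.toLp 2 z = (0 : EuclideanSpace ℝ W) := by
    apply hH.eigenvectorBasis.repr.injective
    ext i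
    have := h _ _ (hH.mulVec_eigenvectorBasis i)
    rw [map_zero, OrthonormalBasis.repr_apply_apply, EuclideanSpace.inner_eq_star_dotProduct]
    simpa [dotProduct_comm] using this
  simpa using congrArg WithLp.ofLp h0

/-- The monic polynomial with simple roots exactly at the eigenvalue support of an integer vector
has rational coefficients. If `φ : ℝ → ℚ` is `ℚ`-linear with `φ 1 = 1`, then applying `φ` to the
coefficients yields another monic polynomial of the same degree which annihilates the vector. -/
theorem exists_rat_coeff_prod_support (M : Matrix W W ℤ) (hM : M.IsSymm) (x : W → ℤ)
    (S : Finset ℝ) (hS : ∀ θ, θ ∈ S ↔ InSupport (M.map (Int.cast : ℤ → ℝ)) (fun i => (x i : ℝ)) θ) :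
    ∃ P : Polynomial ℚ, P.map (algebraMap ℚ ℝ) = ∏ θ ∈ S, (Polynomial.X - Polynomial.C θ) := by
  classical
  set N : Matrix W W ℝ := M.map (Int.cast : ℤ → ℝ) with hNdef
  set xr : W → ℝ := fun i => (x i : ℝ) with hxr
  have hN : N.IsSymm := by rw [Matrix.IsSymm, hNdef, ← Matrix.transpose_map, hM.eq]
  set R : Polynomial ℝ := ∏ θ ∈ S, (Polynomial.X - Polynomial.C θ) with hR
  have hRm : R.Monic := Polynomial.monic_prod_X_sub_C _ _
  have hRd : R.natDegree = S.card := by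
    rw [hR, Polynomial.natDegree_prod_of_monic _ _ (fun i _ => Polynomial.monic_X_sub_C i)]
    simp
  have hRS : ∀ θ ∈ S, R.eval θ = 0 := by
    intro θ hθ
    rw [hR, Polynomial.eval_prod]
    exact Finset.prod_eq_zero hθ (by simp)
  have hRx : (Polynomial.aeval N R) *ᵥ xr = 0 := by
    apply eq_zero_of_forall_eigenvector hN
    intro θ v hv
    rw [dotProduct_aeval_mulVec_of_eigenvector hN hv]
    by_cases h : v ⬝ᵥ xr = 0
    · simp [h]
    · rw [hRS θ ((hS θ).2 ⟨v, hv, h⟩), zero_mul]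
  obtain ⟨φ, hφ⟩ := (Algebra.linearMap ℚ ℝ).exists_leftInverse_of_injective
    (LinearMap.ker_eq_bot.2 (algebraMap ℚ ℝ).injective)
  have hφ1 : φ 1 = 1 := by simpa using LinearMap.congr_fun hφ 1
  let P : Polynomial ℚ :=
    ∑ k ∈ Finset.range (S.card + 1), Polynomial.monomial k (φ (R.coeff k))
  have hPc : ∀ k, k ≤ S.card → P.coeff k = φ (R.coeff k) := by
    intro k hk
    simp only [P, Polynomial.finsetSum_coeff, Polynomial.coeff_monomial]
    rw [Finset.sum_ite_eq' ]
    simp [Nat.lt_succ_of_le hk]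
  have hPc' : ∀ k, S.card < k → P.coeff k = 0 := by
    intro k hk
    simp only [P, Polynomial.finsetSum_coeff, Polynomial.coeff_monomial]
    rw [Finset.sum_ite_eq']
    simp; omega
  have hpow : ∀ k i, ((N ^ k) *ᵥ xr) i = (((M ^ k) *ᵥ x) i : ℤ) := by
    intro k i
    have : N ^ k = (M ^ k).map (Int.cast : ℤ → ℝ) := by
      rw [hNdef]
      exact (map_pow (Int.castRingHom ℝ).mapMatrix M k).symm
    rw [this]
    simp [Matrix.mulVec, dotProduct, hxr]
  have hPx : (Polynomial.aeval N (P.map (algebraMap ℚ ℝ))) *ᵥ xr = 0 := by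
    have e1 : ∀ Q : Polynomial ℝ, Q.natDegree < S.card + 1 → ∀ i,
        ((Polynomial.aeval N Q) *ᵥ xr) i =
          ∑ k ∈ Finset.range (S.card + 1), Q.coeff k * (((M ^ k) *ᵥ x) i : ℤ) := by
      intro Q hQ i
      rw [Polynomial.aeval_eq_sum_range' hQ, Matrix.sum_mulVec, Finset.sum_apply]
      refine Finset.sum_congr rfl fun k _ => ?_
      rw [Matrix.smul_mulVec, Pi.smul_apply, hpow, smul_eq_mul]
    have hPd : (P.map (algebraMap ℚ ℝ)).natDegree < S.card + 1 := by
      rw [Polynomial.natDegree_map, Nat.lt_succ_iff, Polynomial.natDegree_le_iff_coeff_eq_zero]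
      exact hPc'
    ext i
    have h2 := e1 R (by omega) i
    rw [hRx, Pi.zero_apply] at h2
    rw [e1 _ hPd]
    have h3 := congrArg φ h2.symm
    rw [map_zero, map_sum] at h3
    have h4 : ∀ k ∈ Finset.range (S.card + 1), φ (R.coeff k * (((M ^ k) *ᵥ x) i : ℤ)) =
        P.coeff k * (((M ^ k) *ᵥ x) i : ℤ) := by
      intro k hk
      rw [mul_comm, ← zsmul_eq_mul, map_zsmul, zsmul_eq_mul, mul_comm,
        hPc k (Nat.lt_succ_iff.1 (Finset.mem_range.1 hk))]
    rw [Finset.sum_congr rfl h4] at h3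
    have h5 := congrArg (algebraMap ℚ ℝ) h3
    simpa using h5
  refine ⟨P, ?_⟩
  apply Polynomial.eq_of_degree_sub_lt_of_eval_finset_eq S
  · rw [Polynomial.degree_lt_iff_coeff_zero]
    intro k hk
    rw [Polynomial.coeff_sub, Polynomial.coeff_map]
    rcases Nat.lt_or_ge S.card k with h | h
    · rw [hPc' k h, Polynomial.coeff_eq_zero_of_natDegree_lt (by omega : R.natDegree < k)]
      simp
    · have hk' : k = S.card := le_antisymm h hk
      have h1 : R.coeff k = 1 := by rw [hk', ← hRd]; exact hRm.coeff_natDegree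
      rw [hPc k h, h1, hφ1]
      simp
  · intro θ hθ
    obtain ⟨v, hv, hvx⟩ := (hS θ).1 hθ
    have := dotProduct_aeval_mulVec_of_eigenvector hN hv (P.map (algebraMap ℚ ℝ)) xr
    rw [hPx, dotProduct_zero] at this
    rw [hRS θ hθ]
    rcases mul_eq_zero.1 this.symm with h | h
    · exact h
    · exact absurd h hvx

end Support

/-! ### The shape of a support contained in an arithmetic progression -/

/-- A monic polynomial with rational coefficients has rational power sums of order one and two. The
second follows from the first, applied to the polynomial whose roots are the squares. -/
theorem exists_rat_sum_and_sum_sq (S : Finset ℝ) (P : Polynomial ℚ)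
    (hP : P.map (algebraMap ℚ ℝ) = ∏ θ ∈ S, (Polynomial.X - Polynomial.C θ)) :
    (∃ a : ℚ, ∑ θ ∈ S, θ = a) ∧ ∃ b : ℚ, ∑ θ ∈ S, θ ^ 2 = b := by
  have hinj : Function.Injective (algebraMap ℚ ℝ) := (algebraMap ℚ ℝ).injective
  constructor
  · refine ⟨-P.nextCoeff, ?_⟩
    have := Polynomial.prod_X_sub_C_nextCoeff (s := S) (fun θ : ℝ => θ)
    rw [← hP, Polynomial.nextCoeff_map hinj] at this
    simp only [eq_ratCast] at this
    push_cast
    linarith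
  · set Q : Polynomial ℝ := ∏ θ ∈ S, (Polynomial.X - Polynomial.C (θ ^ 2)) with hQ
    -- `∏ (X² - θ²) = ∏ (X - θ) * ∏ (X + θ)`, and the last product is `± P(-X)`.
    have hexp : Polynomial.expand ℝ 2 Q =
        (P * (Polynomial.C ((-1) ^ S.card) * P.comp (-Polynomial.X))).map (algebraMap ℚ ℝ) := by
      rw [Polynomial.map_mul, Polynomial.map_mul, Polynomial.map_comp, hP, Polynomial.map_neg,
        Polynomial.map_X, Polynomial.prod_comp, hQ, map_prod, Polynomial.map_C, map_pow, map_neg,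
        map_one, map_pow, map_neg, map_one, ← Finset.prod_const, ← Finset.prod_mul_distrib,
        ← Finset.prod_mul_distrib]
      refine Finset.prod_congr rfl fun θ _ => ?_
      simp only [map_sub, Polynomial.expand_X, Polynomial.expand_C, Polynomial.sub_comp,
        Polynomial.X_comp, Polynomial.C_comp, map_pow]
      ring
    have hcoef : ∀ k, ∃ b : ℚ, Q.coeff k = b := by
      intro k
      refine ⟨(P * (Polynomial.C ((-1) ^ S.card) * P.comp (-Polynomial.X))).coeff (k * 2), ?_⟩
      rw [← Polynomial.coeff_expand_mul (by norm_num : 0 < 2) Q k, hexp, Polynomial.coeff_map]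
      simp
    have hnext : ∃ b : ℚ, Q.nextCoeff = b := by
      unfold Polynomial.nextCoeff
      split_ifs
      · exact ⟨0, by simp⟩
      · exact hcoef _
    obtain ⟨b, hb⟩ := hnext
    refine ⟨-b, ?_⟩
    have := Polynomial.prod_X_sub_C_nextCoeff (s := S) (fun θ : ℝ => θ ^ 2)
    rw [← hQ, hb] at this
    push_cast
    linarith

/-- A rational polynomial vanishing at `μ + q s`, where `s` is irrational with rational square,
also vanishes at the conjugate `μ - q s`. -/
theorem aeval_conj_eq_zero (P : Polynomial ℚ) (μ q : ℚ) {s : ℝ} {D : ℚ} (hD : s ^ 2 = D)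
    (hs : Irrational s) (h : Polynomial.aeval ((μ : ℝ) + q * s) P = 0) :
    Polynomial.aeval ((μ : ℝ) - q * s) P = 0 := by
  set T : Polynomial ℚ := P.comp (Polynomial.C μ + Polynomial.C q * Polynomial.X) with hT
  have hm : (Polynomial.X ^ 2 - Polynomial.C D : Polynomial ℚ).Monic :=
    Polynomial.monic_X_pow_sub_C D (by norm_num)
  have hdeg : (T %ₘ (Polynomial.X ^ 2 - Polynomial.C D)).natDegree ≤ 1 := by
    have := Polynomial.natDegree_modByMonic_lt T hm (by
      intro h1
      have := congrArg Polynomial.natDegree h1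
      rw [Polynomial.natDegree_X_pow_sub_C] at this
      simp at this)
    rw [Polynomial.natDegree_X_pow_sub_C] at this
    omega
  obtain ⟨a, b, hab⟩ := Polynomial.exists_eq_X_add_C_of_natDegree_le_one hdeg
  have hdiv := Polynomial.modByMonic_add_div T (Polynomial.X ^ 2 - Polynomial.C D)
  have key : ∀ t : ℝ, t ^ 2 = D → Polynomial.aeval ((μ : ℝ) + q * t) P = a * t + b := by
    intro t ht
    have h1 : Polynomial.aeval t T = Polynomial.aeval ((μ : ℝ) + q * t) P := by
      rw [hT, Polynomial.aeval_comp]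
      simp
    rw [← h1, ← hdiv, hab]
    simp [ht]
  have h0 := key s hD
  rw [h] at h0
  have ha : a = 0 := by
    by_contra hne
    apply hs
    refine ⟨-b / a, ?_⟩
    have : (a : ℝ) ≠ 0 := by exact_mod_cast hne
    push_cast
    field_simp
    linarith
  have hb : (b : ℝ) = 0 := by
    rw [ha] at h0
    simp at h0
    exact_mod_cast h0.symm
  have := key (-s) (by rw [neg_sq, hD])
  rw [ha, hb] at this
  rw [sub_eq_add_neg, ← mul_neg]
  simpa using this

/-- If the eigenvalue support of an integer vector lies in an arithmetic progression `c + g ℤ`,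
then it consists of numbers `μ + q s`, with a common rational `μ`, a common `s` whose square is
rational, and rational `q`; if `s` is irrational, then the support is closed under conjugation.
The reason is that the support is the root set of a rational polynomial, so that its sum and the
sum of the squares of its differences are rational. -/
theorem exists_support_form {W : Type*} [Fintype W] [DecidableEq W] (M : Matrix W W ℤ)
    (hM : M.IsSymm) (x : W → ℤ) (c g : ℝ)
    (hcg : ∀ θ, InSupport (M.map (Int.cast : ℤ → ℝ)) (fun i => (x i : ℝ)) θ →
      ∃ n : ℤ, θ = c + g * n) :
    ∃ (μ : ℚ) (s : ℝ) (D : ℚ), s ^ 2 = D ∧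
      ∀ θ, InSupport (M.map (Int.cast : ℤ → ℝ)) (fun i => (x i : ℝ)) θ →
        ∃ q : ℚ, θ = μ + q * s ∧ (Irrational s →
          InSupport (M.map (Int.cast : ℤ → ℝ)) (fun i => (x i : ℝ)) (μ - q * s)) := by
  classical
  set N : Matrix W W ℝ := M.map (Int.cast : ℤ → ℝ)
  set xr : W → ℝ := fun i => (x i : ℝ)
  set S : Finset ℝ := (finite_inSupport N xr).toFinset with hSdef
  have hS : ∀ θ, θ ∈ S ↔ InSupport N xr θ := fun θ => by simp [hSdef]
  obtain ⟨P, hP⟩ := exists_rat_coeff_prod_support M hM x S hS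
  obtain ⟨⟨a, ha⟩, b, hb⟩ := exists_rat_sum_and_sum_sq S P hP
  have hconj : ∀ (μ q : ℚ) (s : ℝ) (D : ℚ), s ^ 2 = D → Irrational s → InSupport N xr (μ + q * s) →
      InSupport N xr (μ - q * s) := by
    intro μ q s D hD hs hin
    have hroot : ∀ t : ℝ, Polynomial.aeval t P = 0 ↔ t ∈ S := by
      intro t
      rw [← Polynomial.eval_map_algebraMap, hP, Polynomial.eval_prod, Finset.prod_eq_zero_iff]
      simp [sub_eq_zero]
    rw [← hS, ← hroot] at hin ⊢
    exact aeval_conj_eq_zero P μ q hD hs hin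
  suffices h : ∃ (μ : ℚ) (s : ℝ) (D : ℚ), s ^ 2 = D ∧
      ∀ θ, InSupport N xr θ → ∃ q : ℚ, θ = μ + q * s by
    obtain ⟨μ, s, D, hD, h⟩ := h
    refine ⟨μ, s, D, hD, fun θ hθ => ?_⟩
    obtain ⟨q, rfl⟩ := h θ hθ
    exact ⟨q, rfl, fun hs => hconj μ q s D hD hs hθ⟩
  rcases S.eq_empty_or_nonempty with hempty | hne
  · refine ⟨0, 0, 0, by simp, fun θ hθ => ?_⟩
    rw [← hS, hempty] at hθ
    simp at hθ
  choose! n hn using hcg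
  have hn' : ∀ θ ∈ S, θ = c + g * n θ := fun θ hθ => hn θ ((hS θ).1 hθ)
  have hk : (S.card : ℝ) ≠ 0 := by exact_mod_cast hne.card_pos.ne'
  have hsum : (a : ℝ) = S.card * c + g * (∑ θ ∈ S, n θ : ℤ) := by
    rw [← ha, Finset.sum_congr rfl hn', Finset.sum_add_distrib, ← Finset.mul_sum]
    simp
  have hsum2 : (b : ℝ) = S.card * c ^ 2 + 2 * c * g * (∑ θ ∈ S, n θ : ℤ)
      + g ^ 2 * (∑ θ ∈ S, n θ ^ 2 : ℤ) := by
    have : ∀ θ ∈ S, θ ^ 2 = c ^ 2 + 2 * c * g * n θ + g ^ 2 * (n θ : ℝ) ^ 2 := by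
      intro θ hθ
      conv_lhs => rw [hn' θ hθ]
      ring
    rw [← hb, Finset.sum_congr rfl this, Finset.sum_add_distrib, Finset.sum_add_distrib,
      ← Finset.mul_sum, ← Finset.mul_sum]
    simp
  set A : ℤ := ∑ θ ∈ S, n θ with hA
  set B : ℤ := ∑ θ ∈ S, n θ ^ 2 with hB
  have hc : c = ((a / S.card : ℚ) : ℝ) - ((A / S.card : ℚ) : ℝ) * g := by
    push_cast
    field_simp
    linarith
  have hform : ∀ θ ∈ S, θ = ((a / S.card : ℚ) : ℝ) + ((n θ - A / S.card : ℚ) : ℝ) * g := by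
    intro θ hθ
    conv_lhs => rw [hn' θ hθ, hc]
    push_cast
    ring
  -- The variance of the integers `n θ`; multiplied by `g ^ 2` it is rational.
  by_cases hv : (S.card : ℤ) * B - A ^ 2 = 0
  · refine ⟨a / S.card, 0, 0, by simp, fun θ hθ => ⟨0, ?_⟩⟩
    have hθS := (hS θ).2 hθ
    have hvar : ∑ η ∈ S, ((S.card : ℤ) * n η - A) ^ 2 = 0 := by
      have : ∀ η ∈ S, ((S.card : ℤ) * n η - A) ^ 2 =
          (S.card : ℤ) ^ 2 * n η ^ 2 - 2 * S.card * A * n η + A ^ 2 := fun η _ => by ring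
      rw [Finset.sum_congr rfl this, Finset.sum_add_distrib, Finset.sum_sub_distrib,
        ← Finset.mul_sum, ← Finset.mul_sum, ← hA, ← hB, Finset.sum_const, nsmul_eq_mul]
      linear_combination (S.card : ℤ) * hv
    have h1 := (Finset.sum_eq_zero_iff_of_nonneg (fun η _ => sq_nonneg _)).1 hvar θ hθS
    have h2 : (S.card : ℝ) * n θ - A = 0 := by exact_mod_cast pow_eq_zero_iff (two_ne_zero) |>.1 h1
    rw [hform θ hθS]
    push_cast
    have : (n θ : ℝ) - A / S.card = 0 := by field_simp; linarith
    rw [this]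
    ring
  · have hv' : ((S.card : ℝ) * B - A ^ 2) ≠ 0 := by exact_mod_cast hv
    refine ⟨a / S.card, g, (S.card * b - a ^ 2) / (S.card * B - A ^ 2), ?_, fun θ hθ =>
      ⟨_, hform θ ((hS θ).2 hθ)⟩⟩
    push_cast
    rw [eq_div_iff hv', hsum, hsum2]
    ring

/-- Eigenvalues of an integer matrix are algebraic integers. -/
theorem isIntegral_of_eigenvector {W : Type*} [Fintype W] [DecidableEq W] (M : Matrix W W ℤ)
    {v : W → ℝ} {θ : ℝ} (hv : M.map (Int.cast : ℤ → ℝ) *ᵥ v = θ • v) (hv0 : v ≠ 0) :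
    IsIntegral ℤ θ := by
  refine ⟨M.charpoly, M.charpoly_monic, ?_⟩
  have hmap : (M.map (Int.cast : ℤ → ℝ)).charpoly = M.charpoly.map (Int.castRingHom ℝ) :=
    (M.charpoly_map (Int.castRingHom ℝ))
  have hev : Module.End.HasEigenvector (Matrix.toLin' (M.map (Int.cast : ℤ → ℝ))) θ v := by
    rw [Module.End.hasEigenvector_iff, Module.End.mem_eigenspace_iff]
    exact ⟨by simpa using hv, hv0⟩
  have h1 := Module.End.aeval_apply_of_hasEigenvector
    (p := (M.map (Int.cast : ℤ → ℝ)).charpoly) hev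
  rw [← Matrix.charpoly_toLin', LinearMap.aeval_self_charpoly, Matrix.charpoly_toLin', hmap] at h1
  have h2 := (smul_eq_zero.1 h1.symm).resolve_right hv0
  rw [Polynomial.eval_map] at h2
  exact h2

/-- A rational algebraic integer is an integer. -/
theorem exists_int_of_isIntegral {q : ℚ} (h : IsIntegral ℤ (q : ℝ)) : ∃ n : ℤ, q = n := by
  have h' : IsIntegral ℤ q :=
    (isIntegral_algHom_iff (Algebra.ofId ℚ ℝ |>.restrictScalars ℤ) (algebraMap ℚ ℝ).injective).1 h
  obtain ⟨n, hn⟩ := IsIntegrallyClosed.isIntegral_iff.1 h'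
  exact ⟨n, by simpa using hn.symm⟩

/-! ### Consequences of perfect pair state transfer for eigenvectors -/

/-- The pair state `e_a - e_b` as an integer vector. -/
def intPair {W : Type*} [DecidableEq W] (a b : W) : W → ℤ := Pi.single a 1 - Pi.single b 1

/-- The pair state `e_a - e_b` as a real vector. -/
def realPair {W : Type*} [DecidableEq W] (a b : W) : W → ℝ := fun i => (intPair a b i : ℝ)

theorem exp_smul_mulVec {W : Type*} [Fintype W] [DecidableEq W] {L : Matrix W W ℂ} {v : W → ℂ}
    {θ : ℂ} (hv : L *ᵥ v = θ • v) (c : ℂ) :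
    NormedSpace.exp (c • L) *ᵥ v = Complex.exp (c * θ) • v := by
  let _ : NormedRing (Matrix W W ℂ) := Matrix.linftyOpNormedRing
  let _ : NormedAlgebra ℂ (Matrix W W ℂ) := Matrix.linftyOpNormedAlgebra
  have h1 := NormedSpace.exp_series_hasSum_exp' (𝕂 := ℂ) (c • L)
  have h2 := NormedSpace.exp_series_hasSum_exp' (𝕂 := ℂ) (c * θ)
  rw [← Complex.exp_eq_exp_ℂ] at h2
  have hpow : ∀ n : ℕ, ((c • L) ^ n) *ᵥ v = (c * θ) ^ n • v := by
    intro n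
    induction n with
    | zero => simp
    | succ n ih =>
      rw [pow_succ', ← Matrix.mulVec_mulVec, ih, Matrix.mulVec_smul, Matrix.smul_mulVec, hv,
        smul_smul, smul_smul]
      congr 1
      ring
  ext i
  have hf : Continuous fun X : Matrix W W ℂ => (X *ᵥ v) i := by
    simp only [Matrix.mulVec, dotProduct]
    fun_prop
  have h3 := h1.map (AddMonoidHom.mk' (fun X : Matrix W W ℂ => (X *ᵥ v) i)
    (fun X Y => by simp [Matrix.add_mulVec])) hf
  have h4 := h2.mul_right (v i)
  refine h3.unique ?_
  convert h4 using 2 with n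
  · rfl
  · simp [Matrix.smul_mulVec, hpow, mul_assoc]
  · simp

theorem lapMatrix_map_intCast {W : Type*} [Fintype W] [DecidableEq W] (H : SimpleGraph W)
    [DecidableRel H.Adj] (R : Type*) [Ring R] :
    (H.lapMatrix ℤ).map (Int.cast : ℤ → R) = H.lapMatrix R := by
  ext i j
  simp only [SimpleGraph.lapMatrix, SimpleGraph.degMatrix, Matrix.map_apply, Matrix.sub_apply,
    Matrix.diagonal_apply, SimpleGraph.adjMatrix_apply]
  split_ifs <;> simp

/-- The overlaps of a real eigenvector with the two pair states of a perfect state transfer agree up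
to a unimodular factor which depends only on the eigenvalue. -/
theorem exp_mul_dotProduct_eq {W : Type*} [Fintype W] [DecidableEq W] (H : SimpleGraph W)
    [DecidableRel H.Adj] {a b c d : W} {τ : ℝ} {χ : ℂ}
    (h : transitionMatrix H τ *ᵥ pairState a b = χ • pairState c d) {θ : ℝ} {v : W → ℝ}
    (hv : H.lapMatrix ℝ *ᵥ v = θ • v) :
    Complex.exp (-(Complex.I * τ) * θ) * ((v ⬝ᵥ realPair a b : ℝ) : ℂ) =
      χ * ((v ⬝ᵥ realPair c d : ℝ) : ℂ) := by
  set vc : W → ℂ := fun i => (v i : ℂ) with hvc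
  have hvc' : H.lapMatrix ℂ *ᵥ vc = (θ : ℂ) • vc := by
    ext i
    have := congrArg (fun t : ℝ => (t : ℂ)) (congrFun hv i)
    rw [← lapMatrix_map_intCast] at this ⊢
    simpa [Matrix.mulVec, dotProduct, hvc] using this
  have hsymm : (transitionMatrix H τ)ᵀ = transitionMatrix H τ := by
    rw [transitionMatrix, ← Matrix.exp_transpose, Matrix.transpose_smul,
      (SimpleGraph.isSymm_lapMatrix (R := ℂ) H).eq]
  have hdot : ∀ a b : W, vc ⬝ᵥ pairState a b = ((v ⬝ᵥ realPair a b : ℝ) : ℂ) := by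
    intro a b
    rw [dotProduct, dotProduct, Complex.ofReal_sum]
    refine Finset.sum_congr rfl fun i _ => ?_
    simp only [pairState, realPair, intPair, hvc, Pi.single_apply, Pi.sub_apply]
    push_cast
    split_ifs <;> simp
  have h1 : vc ⬝ᵥ _ = vc ⬝ᵥ _ := congrArg (fun z => vc ⬝ᵥ z) h
  rw [Matrix.dotProduct_mulVec, ← Matrix.mulVec_transpose, hsymm, transitionMatrix,
    exp_smul_mulVec hvc', smul_dotProduct, dotProduct_smul, hdot, hdot, smul_eq_mul,
    smul_eq_mul] at h1
  exact h1

/-- Perfect pair state transfer makes the two pair states strongly cospectral, with a sign `ε θ` for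
each eigenvalue, and puts the eigenvalue support into an arithmetic progression, unless it takes
place at time `0`. -/
theorem HasPairLPSTBetween.exists_sign {W : Type*} [Fintype W] [DecidableEq W] {H : SimpleGraph W}
    [DecidableRel H.Adj] {a b c d : W} (h : HasPairLPSTBetween H a b c d) :
    (∃ ε : ℝ → ℝ, (∀ θ, ε θ = 1 ∨ ε θ = -1) ∧
      ∀ θ v, H.lapMatrix ℝ *ᵥ v = θ • v → v ⬝ᵥ realPair c d = ε θ * (v ⬝ᵥ realPair a b)) ∧
    ((∃ t g : ℝ, ∀ θ, InSupport (H.lapMatrix ℝ) (realPair a b) θ → ∃ n : ℤ, θ = t + g * n) ∨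
      realPair c d = realPair a b ∨ realPair c d = -realPair a b) := by
  obtain ⟨τ, χ, hχ, h⟩ := h
  have hχ0 : χ ≠ 0 := by
    rintro rfl
    simp at hχ
  set L := H.lapMatrix ℝ with hL
  set x := realPair a b with hx
  set y := realPair c d with hy
  have hsymm : L.IsSymm := SimpleGraph.isSymm_lapMatrix (R := ℝ) H
  set ρ : ℝ → ℂ := fun θ => Complex.exp (-(Complex.I * τ) * θ) / χ with hρ
  have key : ∀ θ v, L *ᵥ v = θ • v → ((v ⬝ᵥ y : ℝ) : ℂ) = ρ θ * ((v ⬝ᵥ x : ℝ) : ℂ) := by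
    intro θ v hv
    have := exp_mul_dotProduct_eq H h hv
    rw [hρ, div_mul_eq_mul_div, hx, this, hy]
    field_simp
  have hnorm : ∀ θ, ‖ρ θ‖ = 1 := by
    intro θ
    rw [hρ]
    simp only
    rw [norm_div, hχ, div_one, Complex.norm_exp]
    simp
  have hreal : ∀ θ, InSupport L x θ → ρ θ = 1 ∨ ρ θ = -1 := by
    rintro θ ⟨v, hv, hvx⟩
    have hvx' : ((v ⬝ᵥ x : ℝ) : ℂ) ≠ 0 := by exact_mod_cast hvx
    have h1 : ρ θ = (((v ⬝ᵥ y) / (v ⬝ᵥ x) : ℝ) : ℂ) := by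
      rw [Complex.ofReal_div, key θ v hv]
      field_simp
    have h2 := hnorm θ
    rw [h1, Complex.norm_real, Real.norm_eq_abs] at h2
    rw [h1]
    rcases (abs_eq zero_le_one).1 h2 with h3 | h3
    · left
      rw [h3, Complex.ofReal_one]
    · right
      rw [h3, Complex.ofReal_neg, Complex.ofReal_one]
  have hsign : ∀ θ : ℝ, ∃ e : ℝ, (e = 1 ∨ e = -1) ∧
      ∀ v, L *ᵥ v = θ • v → v ⬝ᵥ y = e * (v ⬝ᵥ x) := by
    intro θ
    by_cases hθ : InSupport L x θ
    · rcases hreal θ hθ with h1 | h1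
      · refine ⟨1, Or.inl rfl, fun v hv => ?_⟩
        have := key θ v hv
        rw [h1] at this
        exact_mod_cast this
      · refine ⟨-1, Or.inr rfl, fun v hv => ?_⟩
        have := key θ v hv
        rw [h1] at this
        exact_mod_cast this
    · refine ⟨1, Or.inl rfl, fun v hv => ?_⟩
      have h0 : v ⬝ᵥ x = 0 := by
        by_contra hne
        exact hθ ⟨v, hv, hne⟩
      have := key θ v hv
      rw [h0, Complex.ofReal_zero, mul_zero] at this
      rw [h0, mul_zero]
      exact_mod_cast this
  refine ⟨?_, ?_⟩
  · choose ε hε using hsign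
    exact ⟨ε, fun θ => (hε θ).1, fun θ => (hε θ).2⟩
  · by_cases hsupp : ∃ θ₀, InSupport L x θ₀
    swap
    · left
      exact ⟨0, 0, fun θ hθ => absurd ⟨θ, hθ⟩ hsupp⟩
    obtain ⟨θ₀, hθ₀⟩ := hsupp
    by_cases hτ : τ = 0
    · right
      have hconst : ∀ θ, ρ θ = ρ θ₀ := by
        intro θ
        simp [hρ, hτ]
      have hcomb : ∀ e : ℝ, ρ θ₀ = e → y = e • x := by
        intro e he
        rw [← sub_eq_zero]
        apply eq_zero_of_forall_eigenvector hsymm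
        intro θ v hv
        have := key θ v hv
        rw [hconst, he] at this
        have h2 : v ⬝ᵥ y = e * (v ⬝ᵥ x) := by exact_mod_cast this
        rw [dotProduct_sub, dotProduct_smul, h2, smul_eq_mul, sub_self]
      rcases hreal θ₀ hθ₀ with h1 | h1
      · left
        simpa using hcomb 1 (by simp [h1])
      · right
        simpa using hcomb (-1) (by simp [h1])
    · left
      refine ⟨θ₀, Real.pi / τ, fun θ hθ => ?_⟩
      have hsq : ∀ θ, InSupport L x θ → ρ θ ^ 2 = 1 := by
        intro θ hθ
        rcases hreal θ hθ with h1 | h1 <;> rw [h1] <;> norm_num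
      have h1 : (ρ θ₀ / ρ θ) ^ 2 = 1 := by rw [div_pow, hsq _ hθ, hsq _ hθ₀, div_one]
      have h2 : (ρ θ₀ / ρ θ) ^ 2 = Complex.exp (2 * (Complex.I * τ) * (θ - θ₀)) := by
        rw [hρ]
        simp only
        rw [div_div_div_cancel_right₀ hχ0, ← Complex.exp_sub, ← Complex.exp_nat_mul]
        congr 1
        push_cast
        ring
      rw [h1] at h2
      obtain ⟨n, hn⟩ := Complex.exp_eq_one_iff.1 h2.symm
      refine ⟨n, ?_⟩
      have h3 : (2 * Complex.I) * ((τ * (θ - θ₀) : ℝ) : ℂ) =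
          (2 * Complex.I) * ((n * Real.pi : ℝ) : ℂ) := by
        push_cast
        linear_combination hn
      have h4 := mul_left_cancel₀ (mul_ne_zero two_ne_zero Complex.I_ne_zero) h3
      have h5 : τ * (θ - θ₀) = n * Real.pi := by exact_mod_cast h4
      field_simp
      linarith

theorem sym2_eq_of_realPair_eq {W : Type*} [DecidableEq W] {a b c d : W} (hab : a ≠ b)
    (h : realPair c d = realPair a b ∨ realPair c d = -realPair a b) : s(a, b) = s(c, d) := by
  have hval : ∀ (a b i : W),
      realPair a b i = (if i = a then 1 else 0) - (if i = b then 1 else 0) := by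
    intro a b i
    simp [realPair, intPair, Pi.single_apply]
  rw [Sym2.eq_iff]
  rcases h with h | h
  · left
    have h1 := congrFun h a
    have h2 := congrFun h b
    rw [hval, hval] at h1 h2
    constructor
    · by_contra hne
      rw [if_neg hne, if_pos rfl, if_neg hab] at h1
      split_ifs at h1 <;> norm_num at h1
    · by_contra hne
      rw [if_neg hne, if_pos rfl, if_neg hab.symm] at h2
      split_ifs at h2 <;> norm_num at h2
  · right
    have h1 := congrFun h a
    have h2 := congrFun h b
    rw [Pi.neg_apply, hval, hval] at h1 h2
    constructor
    · by_contra hne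
      rw [if_neg hne, if_pos rfl, if_neg hab] at h1
      split_ifs at h1 <;> norm_num at h1
    · by_contra hne
      rw [if_neg hne, if_pos rfl, if_neg hab.symm] at h2
      split_ifs at h2 <;> norm_num at h2

/-! ### The Laplacian matrix of the Q-graph -/

section QGraph

variable {V : Type*} [DecidableEq V] (G : SimpleGraph V)

/-- The vertex-edge incidence matrix of `G`, with columns indexed by the edges of `G` only. -/
def edgeInc : Matrix V G.edgeSet ℝ := Matrix.of fun a e => if a ∈ (e : Sym2 V) then 1 else 0

theorem edgeInc_apply (a : V) (e : G.edgeSet) :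
    edgeInc G a e = if a ∈ (e : Sym2 V) then 1 else 0 := rfl

variable [Fintype V]

theorem edgeInc_transpose_mul_apply (e f : G.edgeSet) :
    ((edgeInc G)ᵀ * edgeInc G) e f =
      if e = f then 2 else if ∃ v : V, v ∈ (e : Sym2 V) ∧ v ∈ (f : Sym2 V) then 1 else 0 := by
  have h0 : ((edgeInc G)ᵀ * edgeInc G) e f =
      ((Finset.univ.filter fun v : V => v ∈ (e : Sym2 V) ∧ v ∈ (f : Sym2 V)).card : ℝ) := by
    rw [Matrix.mul_apply, Finset.card_filter]
    push_cast
    refine Finset.sum_congr rfl fun v _ => ?_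
    rw [Matrix.transpose_apply, edgeInc_apply, edgeInc_apply]
    split_ifs <;> simp_all
  rw [h0]
  split_ifs with h1 h2
  · subst h1
    obtain ⟨e, he⟩ := e
    induction e using Sym2.ind with
    | _ a b =>
      have hab : a ≠ b := G.ne_of_adj he
      have : (Finset.univ.filter fun v : V => v ∈ s(a, b) ∧ v ∈ s(a, b)) = {a, b} := by
        ext v
        simp
      simp only at this ⊢
      rw [this, Finset.card_pair hab]
      norm_num
  · obtain ⟨v, hv⟩ := h2
    have : (Finset.univ.filter fun v : V => v ∈ (e : Sym2 V) ∧ v ∈ (f : Sym2 V)) = {v} := by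
      ext w
      simp only [Finset.mem_filter, Finset.mem_univ, true_and, Finset.mem_singleton]
      constructor
      · intro hw
        by_contra hne
        exact h1 (Subtype.ext (((Sym2.mem_and_mem_iff hne).1 ⟨hw.1, hv.1⟩).trans
          ((Sym2.mem_and_mem_iff hne).1 ⟨hw.2, hv.2⟩).symm))
      · rintro rfl
        exact hv
    rw [this]
    simp
  · rw [Nat.cast_eq_zero, Finset.card_eq_zero, Finset.filter_eq_empty_iff]
    intro v _ hv
    exact h2 ⟨v, hv⟩

theorem adjMatrix_qGraph : (qGraph G).adjMatrix ℝ =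
    Matrix.fromBlocks 0 (edgeInc G) (edgeInc G)ᵀ
      ((edgeInc G)ᵀ * edgeInc G - (2 : ℝ) • (1 : Matrix G.edgeSet G.edgeSet ℝ)) := by
  ext i j
  rw [SimpleGraph.adjMatrix_apply]
  rcases i with a | e <;> rcases j with b | f
  · simp [qGraph, QAdj]
  · simp only [qGraph, QAdj, Matrix.fromBlocks_apply₁₂, edgeInc_apply]
    congr
  · simp only [qGraph, QAdj, Matrix.fromBlocks_apply₂₁, Matrix.transpose_apply, edgeInc_apply]
    congr
  · rw [Matrix.fromBlocks_apply₂₂, Matrix.sub_apply, edgeInc_transpose_mul_apply]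
    by_cases h : e = f
    · simp [h]
    · simp [qGraph, QAdj, h]

theorem sum_edgeInc_col (e : G.edgeSet) : ∑ a, edgeInc G a e = 2 := by
  have h := edgeInc_transpose_mul_apply G e e
  rw [Matrix.mul_apply, if_pos rfl] at h
  rw [← h]
  refine Finset.sum_congr rfl fun a _ => ?_
  rw [Matrix.transpose_apply, edgeInc_apply]
  split_ifs <;> simp

theorem edgeInc_transpose_mulVec_apply_of_adj (v : V → ℝ) {a b : V} (hab : G.Adj a b) :
    ((edgeInc G)ᵀ *ᵥ v) ⟨s(a, b), hab⟩ = v a + v b := by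
  have hne := G.ne_of_adj hab
  have h : ∀ i, (edgeInc G)ᵀ ⟨s(a, b), hab⟩ i * v i =
      (if i = a then v i else 0) + (if i = b then v i else 0) := by
    intro i
    rw [Matrix.transpose_apply, edgeInc_apply]
    simp only [Sym2.mem_iff]
    by_cases h1 : i = a
    · have h2 : i ≠ b := by rw [h1]; exact hne
      simp [h1, hne]
    · by_cases h2 : i = b
      · simp [h2, hne.symm]
      · simp [h1, h2]
  rw [Matrix.mulVec, dotProduct, Finset.sum_congr rfl fun i _ => h i, Finset.sum_add_distrib]
  simp

variable [DecidableRel G.Adj]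

theorem sum_edgeInc_mul (a b : V) :
    ∑ e, edgeInc G a e * edgeInc G b e =
      if a = b then (G.degree a : ℝ) else if G.Adj a b then 1 else 0 := by
  have h := congrFun (congrFun (SimpleGraph.incMatrix_mul_transpose (R := ℝ) G) a) b
  simp only [Matrix.of_apply] at h
  rw [← h, Matrix.mul_apply]
  have h1 : ∀ e : G.edgeSet, edgeInc G a e * edgeInc G b e =
      (fun f : Sym2 V => G.incMatrix ℝ a f * G.incMatrix ℝ b f) e := by
    intro e
    have he := e.2
    simp [edgeInc_apply, SimpleGraph.incMatrix_apply', SimpleGraph.incidenceSet, he]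
  rw [Finset.sum_congr rfl (fun e _ => h1 e)]
  rw [Finset.sum_set_coe (f := fun f : Sym2 V => G.incMatrix ℝ a f * G.incMatrix ℝ b f) G.edgeSet]
  refine Finset.sum_subset (Finset.subset_univ _) fun f _ hf => ?_
  rw [SimpleGraph.incMatrix_of_notMem_incidenceSet, zero_mul]
  exact fun hmem => hf (Set.mem_toFinset.2 hmem.1)

theorem edgeInc_mul_transpose {r : ℕ} (hreg : G.IsRegularOfDegree r) :
    edgeInc G * (edgeInc G)ᵀ = G.adjMatrix ℝ + (r : ℝ) • (1 : Matrix V V ℝ) := by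
  ext a b
  rw [Matrix.mul_apply]
  simp only [Matrix.transpose_apply]
  rw [sum_edgeInc_mul, hreg.degree_eq]
  by_cases h : a = b
  · simp [h]
  · simp [h, SimpleGraph.adjMatrix_apply]

theorem sum_edgeInc_row {r : ℕ} (hreg : G.IsRegularOfDegree r) (a : V) :
    ∑ e, edgeInc G a e = r := by
  have h := sum_edgeInc_mul G a a
  rw [if_pos rfl, hreg.degree_eq] at h
  rw [← h]
  refine Finset.sum_congr rfl fun e _ => ?_
  rw [edgeInc_apply]
  split_ifs <;> simp

theorem degree_qGraph {r : ℕ} (hreg : G.IsRegularOfDegree r) (i : V ⊕ G.edgeSet) :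
    ((qGraph G).degree i : ℝ) = Sum.elim (fun _ => (r : ℝ)) (fun _ => 2 * (r : ℝ)) i := by
  have h := SimpleGraph.adjMatrix_mulVec_const_apply (G := qGraph G) (a := (1 : ℝ)) (v := i)
  rw [mul_one] at h
  rw [← h, adjMatrix_qGraph]
  have hone : (Function.const (V ⊕ G.edgeSet) (1 : ℝ)) = Sum.elim (fun _ => 1) (fun _ => 1) := by
    ext (a | e) <;> rfl
  have hB : edgeInc G *ᵥ (fun _ => 1) = fun _ => (r : ℝ) := by
    ext a
    simp [Matrix.mulVec, dotProduct, sum_edgeInc_row G hreg]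
  have hBt : ∀ c : ℝ, (edgeInc G)ᵀ *ᵥ (fun _ => c) = fun _ => 2 * c := by
    intro c
    ext e
    simp [Matrix.mulVec, dotProduct, ← Finset.sum_mul, sum_edgeInc_col G]
  have hl : (Sum.elim (fun _ : V => (1 : ℝ)) fun _ : G.edgeSet => 1) ∘ Sum.inl = fun _ => 1 := rfl
  have hr : (Sum.elim (fun _ : V => (1 : ℝ)) fun _ : G.edgeSet => 1) ∘ Sum.inr = fun _ => 1 := rfl
  rw [hone, Matrix.fromBlocks_mulVec, hl, hr]
  rcases i with a | e
  · simp [hB]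
  · simp [hBt, Matrix.sub_mulVec, ← Matrix.mulVec_mulVec, hB, Matrix.smul_mulVec]

/-- The matrix `(r + 1) I - L`, where `L` is the Laplacian matrix of the Q-graph. After this shift
the two eigenvalues of the Q-graph that arise from one eigenvalue of an `r`-regular graph `G` have
product `-(r + 1)`. -/
def qMat (r : ℕ) : Matrix (V ⊕ G.edgeSet) (V ⊕ G.edgeSet) ℤ :=
  ((r : ℤ) + 1) • 1 - (qGraph G).lapMatrix ℤ

/-- The matrix `qMat` with real entries. -/
def qMatR (r : ℕ) : Matrix (V ⊕ G.edgeSet) (V ⊕ G.edgeSet) ℝ := (qMat G r).map (Int.cast : ℤ → ℝ)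

theorem qMat_isSymm (r : ℕ) : (qMat G r).IsSymm :=
  (Matrix.isSymm_one.smul _).sub (SimpleGraph.isSymm_lapMatrix (R := ℤ) _)

theorem qMatR_isSymm (r : ℕ) : (qMatR G r).IsSymm := by
  rw [Matrix.IsSymm, qMatR, ← Matrix.transpose_map, (qMat_isSymm G r).eq]

theorem qMatR_eq_sub (r : ℕ) : qMatR G r = ((r : ℝ) + 1) • 1 - (qGraph G).lapMatrix ℝ := by
  rw [← lapMatrix_map_intCast]
  ext i j
  simp only [qMatR, qMat, Matrix.map_apply, Matrix.sub_apply, Matrix.smul_apply, Matrix.one_apply]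
  split_ifs <;> simp

theorem qMatR_mulVec_eq_iff (r : ℕ) (θ : ℝ) (z : V ⊕ G.edgeSet → ℝ) :
    qMatR G r *ᵥ z = ((r : ℝ) + 1 - θ) • z ↔ (qGraph G).lapMatrix ℝ *ᵥ z = θ • z := by
  rw [qMatR_eq_sub, Matrix.sub_mulVec, Matrix.smul_mulVec, Matrix.one_mulVec, sub_smul,
    sub_right_inj]

theorem qMatR_eq_fromBlocks {r : ℕ} (hreg : G.IsRegularOfDegree r) : qMatR G r =
    Matrix.fromBlocks 1 (edgeInc G) (edgeInc G)ᵀ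
      ((edgeInc G)ᵀ * edgeInc G - ((r : ℝ) + 1) • (1 : Matrix G.edgeSet G.edgeSet ℝ)) := by
  rw [qMatR_eq_sub, SimpleGraph.lapMatrix, adjMatrix_qGraph]
  ext i j
  simp only [SimpleGraph.degMatrix, Matrix.sub_apply, Matrix.smul_apply, Matrix.diagonal_apply,
    degree_qGraph G hreg, Matrix.one_apply]
  rcases i with a | e <;> rcases j with b | f
  · by_cases h : a = b <;> simp [h]
  · simp
  · simp
  · by_cases h : e = f
    · simp [h]
      ring
    · simp [h]

theorem qMatR_mulVec {r : ℕ} (hreg : G.IsRegularOfDegree r) (v : V → ℝ) (u : G.edgeSet → ℝ) :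
    qMatR G r *ᵥ Sum.elim v u = Sum.elim (v + edgeInc G *ᵥ u)
      ((edgeInc G)ᵀ *ᵥ (v + edgeInc G *ᵥ u) - ((r : ℝ) + 1) • u) := by
  rw [qMatR_eq_fromBlocks G hreg, Matrix.fromBlocks_mulVec]
  simp [Matrix.sub_mulVec, Matrix.mulVec_add, Matrix.smul_mulVec, add_sub_assoc]

end QGraph

/-! ### Eigenvalues and eigenvectors of the Q-graph of a regular graph -/

section Eigen

variable {V : Type*} [Fintype V] [DecidableEq V] {G : SimpleGraph V} [DecidableRel G.Adj] {r : ℕ}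

theorem edgeInc_mulVec_transpose_mulVec (hreg : G.IsRegularOfDegree r) (v : V → ℝ) :
    edgeInc G *ᵥ ((edgeInc G)ᵀ *ᵥ v) = G.adjMatrix ℝ *ᵥ v + (r : ℝ) • v := by
  rw [Matrix.mulVec_mulVec, edgeInc_mul_transpose G hreg, Matrix.add_mulVec, Matrix.smul_mulVec,
    Matrix.one_mulVec]

/-- An eigenvector of `G` lifts to eigenvectors of the Q-graph, one for each root of
`ζ² = α ζ + (r + 1)`. -/
theorem qMatR_mulVec_lift (hreg : G.IsRegularOfDegree r) {v : V → ℝ} {α ζ : ℝ}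
    (hv : G.adjMatrix ℝ *ᵥ v = α • v) (hζ : ζ ^ 2 = α * ζ + (r + 1)) :
    qMatR G r *ᵥ Sum.elim ((ζ + 1 - α) • v) ((edgeInc G)ᵀ *ᵥ v) =
      ζ • Sum.elim ((ζ + 1 - α) • v) ((edgeInc G)ᵀ *ᵥ v) := by
  have h1 : (ζ + 1 - α) • v + edgeInc G *ᵥ ((edgeInc G)ᵀ *ᵥ v) = (ζ + (r + 1)) • v := by
    rw [edgeInc_mulVec_transpose_mulVec hreg, hv, ← add_smul, ← add_smul]
    congr 1
    ring
  rw [qMatR_mulVec G hreg, h1, Matrix.mulVec_smul]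
  ext (a | e)
  · simp only [Sum.elim_inl, Pi.smul_apply, smul_eq_mul]
    linear_combination -(v a) * hζ
  · simp only [Sum.elim_inr, Pi.smul_apply, Pi.sub_apply, smul_eq_mul]
    ring

theorem dotProduct_edgeInc_mulVec (v : V → ℝ) (u : G.edgeSet → ℝ) :
    v ⬝ᵥ (edgeInc G *ᵥ u) = ((edgeInc G)ᵀ *ᵥ v) ⬝ᵥ u := by
  rw [Matrix.dotProduct_mulVec, ← Matrix.mulVec_transpose]

/-- Eigenvectors for `-r` change sign along every edge: `‖Bᵀ v‖² = ⟨v, (A + r) v⟩ = 0`. -/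
theorem edgeInc_transpose_mulVec_eq_zero (hreg : G.IsRegularOfDegree r) {v : V → ℝ}
    (hv : G.adjMatrix ℝ *ᵥ v = (-(r : ℝ)) • v) : (edgeInc G)ᵀ *ᵥ v = 0 := by
  rw [← dotProduct_self_eq_zero (R := ℝ), ← dotProduct_edgeInc_mulVec,
    edgeInc_mulVec_transpose_mulVec hreg, hv, ← add_smul]
  simp

/-- Both `A + r = B Bᵀ` and the Laplacian matrix `r - A` are positive semidefinite. -/
theorem abs_eigenvalue_le (hreg : G.IsRegularOfDegree r) {v : V → ℝ} {α : ℝ}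
    (hv : G.adjMatrix ℝ *ᵥ v = α • v) (hv0 : v ≠ 0) : |α| ≤ r := by
  have hpos : 0 < v ⬝ᵥ v := by
    have h1 : 0 ≤ v ⬝ᵥ v := Finset.sum_nonneg fun i _ => mul_self_nonneg (v i)
    exact lt_of_le_of_ne h1 fun h => hv0 (dotProduct_self_eq_zero.1 h.symm)
  have hlow : 0 ≤ (α + r) * (v ⬝ᵥ v) := by
    have h : v ⬝ᵥ (edgeInc G *ᵥ ((edgeInc G)ᵀ *ᵥ v)) = (α + r) * (v ⬝ᵥ v) := by
      rw [edgeInc_mulVec_transpose_mulVec hreg, hv, ← add_smul, dotProduct_smul, smul_eq_mul]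
    rw [← h, dotProduct_edgeInc_mulVec]
    exact Finset.sum_nonneg fun i _ => mul_self_nonneg _
  have hupp : 0 ≤ (r - α) * (v ⬝ᵥ v) := by
    have h := (SimpleGraph.posSemidef_lapMatrix ℝ G).dotProduct_mulVec_nonneg v
    have hL : G.lapMatrix ℝ *ᵥ v = (r - α) • v := by
      ext i
      have := congrFun hv i
      rw [SimpleGraph.lapMatrix_mulVec_apply, hreg.degree_eq]
      rw [SimpleGraph.adjMatrix_mulVec_apply] at this
      rw [this]
      simp
      ring
    rw [hL, dotProduct_smul, star_trivial, smul_eq_mul] at h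
    exact h
  rw [abs_le]
  constructor <;> nlinarith

/-- On a connected regular graph the eigenvectors for the largest eigenvalue are constant. -/
theorem eigenvector_const (hconn : G.Connected) (hreg : G.IsRegularOfDegree r) {v : V → ℝ}
    (hv : G.adjMatrix ℝ *ᵥ v = (r : ℝ) • v) (a b : V) : v a = v b := by
  refine (SimpleGraph.lapMatrix_mulVec_eq_zero_iff_forall_reachable G).1 ?_ a b
    (hconn.preconnected a b)
  ext i
  have := congrFun hv i
  rw [SimpleGraph.lapMatrix_mulVec_apply, hreg.degree_eq]
  rw [SimpleGraph.adjMatrix_mulVec_apply] at this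
  rw [this]
  simp

theorem qMatR_eigen_vertex (hreg : G.IsRegularOfDegree r) {z : V ⊕ G.edgeSet → ℝ} {ζ : ℝ}
    (hz : qMatR G r *ᵥ z = ζ • z) :
    z ∘ Sum.inl + edgeInc G *ᵥ (z ∘ Sum.inr) = ζ • (z ∘ Sum.inl) := by
  rw [← Sum.elim_comp_inl_inr z, qMatR_mulVec G hreg] at hz
  exact funext fun a => congrFun hz (Sum.inl a)

theorem qMatR_eigen_edge (hreg : G.IsRegularOfDegree r) {z : V ⊕ G.edgeSet → ℝ} {ζ : ℝ}
    (hz : qMatR G r *ᵥ z = ζ • z) :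
    ζ • ((edgeInc G)ᵀ *ᵥ (z ∘ Sum.inl)) = (ζ + (r + 1)) • (z ∘ Sum.inr) := by
  have h1 := qMatR_eigen_vertex hreg hz
  rw [← Sum.elim_comp_inl_inr z, qMatR_mulVec G hreg, h1, Matrix.mulVec_smul] at hz
  have h2 : ζ • ((edgeInc G)ᵀ *ᵥ (z ∘ Sum.inl)) - ((r : ℝ) + 1) • (z ∘ Sum.inr) =
      ζ • (z ∘ Sum.inr) := funext fun e => congrFun hz (Sum.inr e)
  rw [add_smul, ← h2]
  abel

theorem qMatR_eigenvalue_ne_zero (hreg : G.IsRegularOfDegree r) {z : V ⊕ G.edgeSet → ℝ} {ζ : ℝ}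
    (hz : qMatR G r *ᵥ z = ζ • z) (hz0 : z ≠ 0) : ζ ≠ 0 := by
  rintro rfl
  have h1 := qMatR_eigen_vertex hreg hz
  have h2 := qMatR_eigen_edge hreg hz
  rw [zero_smul, zero_add, eq_comm, smul_eq_zero] at h2
  have h3 : z ∘ Sum.inr = 0 := h2.resolve_left (by positivity)
  rw [h3, Matrix.mulVec_zero, add_zero, zero_smul] at h1
  apply hz0
  rw [← Sum.elim_comp_inl_inr z, h1, h3]
  ext (a | e) <;> rfl

/-- The vertex part of an eigenvector of the Q-graph is an eigenvector of `G`, or zero. -/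
theorem adjMatrix_mulVec_of_qMatR_eigen (hreg : G.IsRegularOfDegree r) {z : V ⊕ G.edgeSet → ℝ}
    {ζ : ℝ} (hz : qMatR G r *ᵥ z = ζ • z) (hζ : ζ ≠ 0) :
    G.adjMatrix ℝ *ᵥ (z ∘ Sum.inl) = (ζ - (r + 1) / ζ) • (z ∘ Sum.inl) := by
  have h1 := qMatR_eigen_vertex hreg hz
  have h2 := congrArg (fun t => edgeInc G *ᵥ t) (qMatR_eigen_edge hreg hz)
  simp only [Matrix.mulVec_smul] at h2
  rw [edgeInc_mulVec_transpose_mulVec hreg] at h2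
  ext a
  have h3 := congrFun h1 a
  have h4 := congrFun h2 a
  simp only [Pi.add_apply, Pi.smul_apply, smul_eq_mul] at h3 h4 ⊢
  field_simp
  linear_combination h4 + (ζ + (r + 1)) * h3

theorem eigenvalue_eq_of_vertex_eq_zero (hreg : G.IsRegularOfDegree r) {z : V ⊕ G.edgeSet → ℝ}
    {ζ : ℝ} (hz : qMatR G r *ᵥ z = ζ • z) (hz0 : z ≠ 0) (hv : z ∘ Sum.inl = 0) :
    ζ = -(r + 1) := by
  have h2 := qMatR_eigen_edge hreg hz
  rw [hv, Matrix.mulVec_zero, smul_zero, eq_comm, smul_eq_zero] at h2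
  rcases h2 with h | h
  · linarith
  · exfalso
    apply hz0
    rw [← Sum.elim_comp_inl_inr z, hv, h]
    ext (a | e) <;> rfl

theorem isIntegral_adjMatrix_eigenvalue {v : V → ℝ} {α : ℝ}
    (hv : G.adjMatrix ℝ *ᵥ v = α • v) (hv0 : v ≠ 0) : IsIntegral ℤ α := by
  refine isIntegral_of_eigenvector (G.adjMatrix ℤ) ?_ hv0
  rw [← hv]
  congr 1
  ext i j
  simp [SimpleGraph.adjMatrix_apply]

/-- With `ζ`, also `(r + 1) / ζ` is an algebraic integer, since it is `ζ` minus an eigenvalue of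
`G`. -/
theorem isIntegral_add_one_div (hreg : G.IsRegularOfDegree r) {z : V ⊕ G.edgeSet → ℝ}
    {ζ : ℝ} (hz : qMatR G r *ᵥ z = ζ • z) (hv : z ∘ Sum.inl ≠ 0) :
    IsIntegral ℤ ζ ∧ IsIntegral ℤ (((r : ℝ) + 1) / ζ) := by
  have hz0 : z ≠ 0 := by
    rintro rfl
    exact hv rfl
  have h1 : IsIntegral ℤ ζ := isIntegral_of_eigenvector (qMat G r) hz hz0
  have h2 := isIntegral_adjMatrix_eigenvalue
    (adjMatrix_mulVec_of_qMatR_eigen hreg hz (qMatR_eigenvalue_ne_zero hreg hz hz0)) hv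
  refine ⟨h1, ?_⟩
  have := h1.sub h2
  rwa [sub_sub_cancel] at this

/-- A rational eigenvalue `ζ` of `qMatR` divides the prime `r + 1` up to sign, as `(r + 1) / ζ` is an
integer as well. -/
theorem rational_eigenvalue (hreg : G.IsRegularOfDegree r) (hp : (r + 1).Prime)
    {z : V ⊕ G.edgeSet → ℝ} {ζ : ℝ} (hz : qMatR G r *ᵥ z = ζ • z) (hv : z ∘ Sum.inl ≠ 0)
    (hrat : ∃ q : ℚ, ζ = q) :
    ζ = 1 ∨ ζ = -1 ∨ ζ = r + 1 ∨ ζ = -(r + 1) := by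
  have hz0 : z ≠ 0 := by
    rintro rfl
    exact hv rfl
  have hζ0 := qMatR_eigenvalue_ne_zero hreg hz hz0
  obtain ⟨h1, h2⟩ := isIntegral_add_one_div hreg hz hv
  obtain ⟨q, rfl⟩ := hrat
  obtain ⟨n, rfl⟩ := exists_int_of_isIntegral h1
  have h3 : ((r : ℝ) + 1) / ((n : ℚ) : ℝ) = (((r + 1 : ℚ) / n : ℚ) : ℝ) := by push_cast; ring
  rw [h3] at h2
  obtain ⟨m, hm⟩ := exists_int_of_isIntegral h2
  have hn0 : (n : ℚ) ≠ 0 := by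
    intro h
    apply hζ0
    rw [h]
    simp
  rw [div_eq_iff hn0] at hm
  have hdvd : n ∣ ((r + 1 : ℕ) : ℤ) := ⟨m, by
    have : ((r : ℤ) + 1) = m * n := by exact_mod_cast hm
    push_cast
    rw [this, mul_comm]⟩
  have h4 := (Nat.dvd_prime hp).1 (Int.natAbs_dvd_natAbs.2 hdvd)
  rcases h4 with h | h
  · rcases Int.natAbs_eq n with h' | h' <;> rw [h', h] <;> simp
  · rcases Int.natAbs_eq n with h' | h' <;> rw [h', h] <;> simp [add_comm]

theorem rational_eigenvalue_adj (hreg : G.IsRegularOfDegree r) (hp : (r + 1).Prime)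
    {z : V ⊕ G.edgeSet → ℝ} {ζ : ℝ} (hz : qMatR G r *ᵥ z = ζ • z) (hv : z ∘ Sum.inl ≠ 0)
    (hrat : ∃ q : ℚ, ζ = q) {α : ℝ} (hα : ζ ^ 2 = α * ζ + (r + 1)) : α = r ∨ α = -r := by
  have hr : (r : ℝ) + 1 ≠ 0 := by positivity
  rcases rational_eigenvalue hreg hp hz hv hrat with h | h | h | h <;> rw [h] at hα
  · right; linarith
  · left; linarith
  · left
    apply mul_right_cancel₀ hr
    linarith
  · right
    apply mul_right_cancel₀ hr
    linarith

end Eigen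

/-! ### Pair states with an irrational eigenvalue in their support -/

theorem dotProduct_realPair {W : Type*} [Fintype W] [DecidableEq W] (z : W → ℝ) (a b : W) :
    z ⬝ᵥ realPair a b = z a - z b := by
  have h : realPair a b = Pi.single a 1 - Pi.single b 1 := by
    ext i
    simp [realPair, intPair, Pi.single_apply]
  rw [h, dotProduct_sub, dotProduct_single, dotProduct_single, mul_one, mul_one]

theorem inSupport_realPair_iff {W : Type*} [Fintype W] [DecidableEq W] (N : Matrix W W ℝ) (a b : W)
    (θ : ℝ) : InSupport N (realPair a b) θ ↔ ∃ z, N *ᵥ z = θ • z ∧ z a ≠ z b := by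
  simp only [InSupport, dotProduct_realPair, sub_ne_zero]

theorem realPair_apply_of_ne {W : Type*} [DecidableEq W] {a b i : W} (ha : i ≠ a) (hb : i ≠ b) :
    realPair a b i = 0 := by
  simp [realPair, intPair, ha, hb]

theorem eq_zero_of_mul_irrational_rat {q c : ℚ} {s : ℝ} (hs : Irrational s) (h : (q : ℝ) * s = c) :
    q = 0 := by
  by_contra hq
  apply hs
  refine ⟨c / q, ?_⟩
  have : (q : ℝ) ≠ 0 := by exact_mod_cast hq
  push_cast
  field_simp
  linarith

section Cases

variable {V : Type*} [Fintype V] [DecidableEq V] {G : SimpleGraph V} [DecidableRel G.Adj] {r : ℕ}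

/-- The spectral consequences of perfect pair state transfer, stated for the shifted matrix
`qMatR`. -/
theorem exists_sign_and_form {a b c d : V ⊕ G.edgeSet}
    (hab : a ≠ b) (hne : s(a, b) ≠ s(c, d)) (h : HasPairLPSTBetween (qGraph G) a b c d) (r : ℕ) :
    (∃ ε : ℝ → ℝ, (∀ θ, ε θ = 1 ∨ ε θ = -1) ∧
      ∀ θ z, qMatR G r *ᵥ z = θ • z → z ⬝ᵥ realPair c d = ε θ * (z ⬝ᵥ realPair a b)) ∧
    ∃ (μ : ℚ) (s : ℝ) (D : ℚ), s ^ 2 = D ∧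
      ∀ θ, InSupport (qMatR G r) (realPair a b) θ → ∃ q : ℚ, θ = μ + q * s ∧
        (Irrational s → InSupport (qMatR G r) (realPair a b) (μ - q * s)) := by
  obtain ⟨⟨ε, hε, hεz⟩, h2⟩ := h.exists_sign
  have hiff : ∀ (θ : ℝ) z, qMatR G r *ᵥ z = θ • z ↔
      (qGraph G).lapMatrix ℝ *ᵥ z = ((r : ℝ) + 1 - θ) • z := by
    intro θ z
    rw [← qMatR_mulVec_eq_iff, sub_sub_cancel]
  refine ⟨⟨fun θ => ε (r + 1 - θ), fun θ => hε _, fun θ z hz => hεz _ _ ((hiff θ z).1 hz)⟩, ?_⟩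
  rcases h2 with ⟨t, g, htg⟩ | h2
  · refine exists_support_form (qMat G r) (qMat_isSymm G r) (intPair a b) (r + 1 - t) (-g) ?_
    rintro θ ⟨z, hz, hzx⟩
    obtain ⟨n, hn⟩ := htg (r + 1 - θ) ⟨z, (hiff θ z).1 hz, hzx⟩
    exact ⟨n, by linarith⟩
  · exact absurd (sym2_eq_of_realPair_eq hab h2) hne

/-- Eigenvectors without vertex part belong to the rational eigenvalue `-(r + 1)`. -/
theorem vertex_ne_zero_of_irrational (hreg : G.IsRegularOfDegree r) {z : V ⊕ G.edgeSet → ℝ} {ζ : ℝ}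
    (hz : qMatR G r *ᵥ z = ζ • z) (hz0 : z ≠ 0) (hζ : Irrational ζ) : z ∘ Sum.inl ≠ 0 := by
  intro h
  apply hζ
  refine ⟨-(r + 1), ?_⟩
  rw [eigenvalue_eq_of_vertex_eq_zero hreg hz hz0 h]
  push_cast
  ring

/-- If the support contains, along with an irrational eigenvalue `ζ`, the other root `-(r + 1) / ζ`
belonging to the same eigenvalue of `G`, then that eigenvalue of `G` is `2 μ`, where `μ` is the
rational part common to all eigenvalues in the support. -/
theorem sq_eq_of_partner (hp : (r + 1).Prime)
    {x : V ⊕ G.edgeSet → ℝ} {μ D : ℚ} {s : ℝ} (hD : s ^ 2 = D)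
    (hform : ∀ θ, InSupport (qMatR G r) x θ → ∃ q : ℚ, θ = μ + q * s) {ζ : ℝ}
    (hζ : Irrational ζ) (h1 : InSupport (qMatR G r) x ζ)
    (h2 : InSupport (qMatR G r) x (-(r + 1) / ζ)) : ζ ^ 2 = 2 * μ * ζ + (r + 1) := by
  have hζ0 : ζ ≠ 0 := hζ.ne_zero
  obtain ⟨q₁, hq₁⟩ := hform _ h1
  obtain ⟨q₂, hq₂⟩ := hform _ h2
  have hs : Irrational s := by
    by_contra hs
    obtain ⟨t, rfl⟩ := exists_rat_of_not_irrational hs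
    exact hζ ⟨μ + q₁ * t, by rw [hq₁]; push_cast; ring⟩
  have hprod : ζ * (-(r + 1) / ζ) = -(r + 1) := by field_simp
  have hrat : ((μ * (q₁ + q₂) : ℚ) : ℝ) * s = ((-(r + 1) - μ ^ 2 - q₁ * q₂ * D : ℚ) : ℝ) := by
    rw [hq₂] at hprod
    rw [hq₁] at hprod
    push_cast
    rw [← hD]
    linear_combination hprod
  rcases mul_eq_zero.1 (eq_zero_of_mul_irrational_rat hs hrat) with hμ | hq
  · -- Now `μ = 0`, so that `ζ ^ 2` and `(-(r + 1) / ζ) ^ 2` are integers whose product is the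
    -- square of a prime.
    have hint : ∀ (θ : ℝ) (q : ℚ), InSupport (qMatR G r) x θ → θ = μ + q * s →
        ∃ n : ℤ, θ ^ 2 = n := by
      rintro θ q ⟨z, hz, hzx⟩ hθ
      have hi : IsIntegral ℤ (θ ^ 2) := by
        refine (isIntegral_of_eigenvector (qMat G r) hz ?_).pow 2
        rintro rfl
        simp at hzx
      have hθ2 : θ ^ 2 = ((q ^ 2 * D : ℚ) : ℝ) := by
        rw [hθ, hμ]
        push_cast
        rw [← hD]
        ring
      rw [hθ2] at hi ⊢
      obtain ⟨n, hn⟩ := exists_int_of_isIntegral hi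
      exact ⟨n, by rw [hn]; simp⟩
    obtain ⟨n, hn⟩ := hint _ _ h1 hq₁
    obtain ⟨m, hm⟩ := hint _ _ h2 hq₂
    have hnm : n * m = ((r + 1 : ℕ) : ℤ) ^ 2 := by
      have : (n : ℝ) * m = ((r : ℝ) + 1) ^ 2 := by
        rw [← hn, ← hm, ← mul_pow, hprod]
        ring
      exact_mod_cast this
    have hn0 : 0 ≤ n := by
      have : (0 : ℝ) ≤ n := by rw [← hn]; positivity
      exact_mod_cast this
    obtain ⟨k, rfl⟩ := Int.eq_ofNat_of_zero_le hn0
    have hk : k ∣ (r + 1) ^ 2 := by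
      have : (k : ℤ) ∣ (((r + 1) ^ 2 : ℕ) : ℤ) := ⟨m, by rw [hnm]; push_cast; ring⟩
      exact_mod_cast this
    obtain ⟨i, hi, rfl⟩ := (Nat.dvd_prime_pow hp).1 hk
    have hn' : ζ ^ 2 = ((r : ℝ) + 1) ^ i := by
      rw [hn]
      push_cast
      ring
    interval_cases i
    · exfalso
      rcases sq_eq_one_iff.1 (hn'.trans (pow_zero _)) with h | h
      · exact hζ ⟨1, by rw [h]; push_cast; ring⟩
      · exact hζ ⟨-1, by rw [h]; push_cast; ring⟩
    · rw [hn', hμ]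
      simp
    · exfalso
      rcases sq_eq_sq_iff_eq_or_eq_neg.1 hn' with h | h
      · exact hζ ⟨r + 1, by rw [h]; push_cast; ring⟩
      · exact hζ ⟨-(r + 1), by rw [h]; push_cast; ring⟩
  · have hsum : ζ + -(r + 1) / ζ = 2 * μ := by
      have : (q₁ : ℝ) + q₂ = 0 := by exact_mod_cast hq
      rw [hq₂, hq₁]
      linear_combination s * this
    field_simp at hsum
    linarith

theorem exists_rat_qMatR_mulVec_sub (μ : ℚ) {f : V ⊕ G.edgeSet → ℝ} (hf : ∀ i, ∃ q : ℚ, f i = q) :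
    ∀ i, ∃ q : ℚ, (qMatR G r *ᵥ f - (μ : ℝ) • f) i = q := by
  choose q hq using hf
  intro i
  refine ⟨∑ j, (qMat G r i j : ℚ) * q j - μ * q i, ?_⟩
  simp [Matrix.mulVec, dotProduct, qMatR, hq]

/-- If the support of `e_a - e_b` contains an irrational eigenvalue, and is closed under passing to
the other root belonging to the same eigenvalue of `G`, then there is no transfer. The signs at
the two conjugate eigenvalues `μ ± w` must agree, because the pair states are rational. Hence the
second pair state differs, up to sign, from the first one by an eigenvector for the rational
eigenvalue `μ = ± 1`; but such an eigenvector is nonzero on a vertex of `G` and all its `r ≥ 4`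
neighbours, whereas the difference has at most four nonzero entries. -/
theorem false_of_irrational_of_partner (hr : 2 ≤ r) (hconn : G.Connected)
    (hreg : G.IsRegularOfDegree r) (hp : (r + 1).Prime) {a b c d : V ⊕ G.edgeSet}
    (hab : a ≠ b) (hne : s(a, b) ≠ s(c, d)) (h : HasPairLPSTBetween (qGraph G) a b c d)
    (hpartner : ∀ ζ, Irrational ζ → InSupport (qMatR G r) (realPair a b) ζ →
      InSupport (qMatR G r) (realPair a b) (-(r + 1) / ζ))
    {ζ₀ : ℝ} (hζ₀ : Irrational ζ₀) (hin₀ : InSupport (qMatR G r) (realPair a b) ζ₀) : False := by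
  obtain ⟨⟨ε, hε, hεz⟩, μ, s, D, hD, hform'⟩ := exists_sign_and_form hab hne h r
  have hform : ∀ θ, InSupport (qMatR G r) (realPair a b) θ → ∃ q : ℚ, θ = μ + q * s :=
    fun θ hθ => (hform' θ hθ).imp fun _ => And.left
  set N := qMatR G r with hN
  set x := realPair a b with hx
  set y := realPair c d with hy
  have hNs : N.IsSymm := qMatR_isSymm G r
  have hs : Irrational s := by
    by_contra hs
    obtain ⟨t, rfl⟩ := exists_rat_of_not_irrational hs
    obtain ⟨q, hq⟩ := hform _ hin₀
    exact hζ₀ ⟨μ + q * t, by rw [hq]; push_cast; ring⟩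
  have hquad : ∀ ζ, Irrational ζ → InSupport N x ζ → ζ ^ 2 = 2 * μ * ζ + (r + 1) :=
    fun ζ h1 h2 => sq_eq_of_partner hp hD hform h1 h2 (hpartner ζ h1 h2)
  set w : ℝ := ζ₀ - μ with hw
  have hw2 : w ^ 2 = μ ^ 2 + (r + 1) := by
    rw [hw]
    linear_combination hquad ζ₀ hζ₀ hin₀
  have hwirr : Irrational w := by
    rw [hw]
    exact hζ₀.sub_ratCast μ
  have hw0 : w ≠ 0 := hwirr.ne_zero
  have hcases : ∀ ζ, InSupport N x ζ → ζ = μ ∨ ζ = μ + w ∨ ζ = μ - w := by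
    intro ζ hζ
    by_cases hirr : Irrational ζ
    · right
      have h1 : (ζ - μ) ^ 2 = w ^ 2 := by
        rw [hw2]
        linear_combination hquad ζ hirr hζ
      rcases sq_eq_sq_iff_eq_or_eq_neg.1 h1 with h2 | h2
      · left; linarith
      · right; linarith
    · left
      obtain ⟨t, rfl⟩ := exists_rat_of_not_irrational hirr
      obtain ⟨q, hq⟩ := hform _ hζ
      have : q = 0 := eq_zero_of_mul_irrational_rat (c := t - μ) hs (by push_cast; linarith)
      rw [hq, this]
      simp
  have hdot : ∀ (θ : ℝ) z, N *ᵥ z = θ • z → ∀ f, z ⬝ᵥ (N *ᵥ f - (μ : ℝ) • f) =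
      (θ - μ) * (z ⬝ᵥ f) := by
    intro θ z hz f
    rw [dotProduct_sub, dotProduct_mulVec_of_eigenvector hNs hz, dotProduct_smul, smul_eq_mul,
      sub_mul]
  have hpair : ∀ (a b : V ⊕ G.edgeSet) i, ∃ q : ℚ, realPair a b i = q :=
    fun a b i => ⟨intPair a b i, by simp [realPair]⟩
  by_cases hsame : ε (μ + w) = ε (μ - w)
  · set e := ε (μ + w) with he
    set Z := y - e • x with hZ
    have hZeig : N *ᵥ Z = (μ : ℝ) • Z := by
      rw [← sub_eq_zero]
      apply eq_zero_of_forall_eigenvector hNs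
      intro θ z hz
      rw [hdot θ z hz, hZ, dotProduct_sub, dotProduct_smul, hεz θ z hz, smul_eq_mul]
      by_cases hzx : z ⬝ᵥ x = 0
      · rw [hzx]; ring
      · rcases hcases θ ⟨z, hz, hzx⟩ with rfl | rfl | rfl
        · ring
        · rw [← he]; ring
        · rw [← hsame]; ring
    have hZ0 : Z ≠ 0 := by
      intro h0
      rw [hZ, sub_eq_zero] at h0
      apply hne
      apply sym2_eq_of_realPair_eq hab
      rcases hε (μ + w) with h1 | h1
      · left
        rw [← hy, h0, he, h1, one_smul]
      · right
        rw [← hy, h0, he, h1, neg_one_smul]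
    -- `2 μ` is an eigenvalue of `G`.
    have hbound : |2 * (μ : ℝ)| ≤ r := by
      obtain ⟨z, hz, hzx⟩ := hin₀
      have hz0 : z ≠ 0 := by
        rintro rfl
        simp at hzx
      have h1 := adjMatrix_mulVec_of_qMatR_eigen hreg hz hζ₀.ne_zero
      have h2 : ζ₀ - (r + 1) / ζ₀ = 2 * μ := by
        have := hquad ζ₀ hζ₀ ⟨z, hz, hzx⟩
        have h3 := hζ₀.ne_zero
        field_simp
        linarith
      rw [h2] at h1
      exact abs_eigenvalue_le hreg h1 (vertex_ne_zero_of_irrational hreg hz hz0 hζ₀)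
    rw [abs_le] at hbound
    have hr' : (2 : ℝ) ≤ r := by exact_mod_cast hr
    have hZv : Z ∘ Sum.inl ≠ 0 := by
      intro h0
      have := eigenvalue_eq_of_vertex_eq_zero hreg hZeig hZ0 h0
      linarith
    have hμ : (μ : ℝ) = 1 ∨ (μ : ℝ) = -1 := by
      rcases rational_eigenvalue hreg hp hZeig hZv ⟨μ, rfl⟩ with h1 | h1 | h1 | h1
      · exact Or.inl h1
      · exact Or.inr h1
      · linarith
      · linarith
    have hr4 : 4 ≤ r := by
      by_contra hlt
      have hr23 : r = 2 ∨ r = 3 := by omega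
      rcases hr23 with rfl | rfl
      · have h4 : w ^ 2 = 2 ^ 2 := by
          rw [hw2]
          rcases hμ with h1 | h1 <;> rw [h1] <;> norm_num
        rcases sq_eq_sq_iff_eq_or_eq_neg.1 h4 with h5 | h5
        · exact hwirr ⟨2, by rw [h5]; norm_num⟩
        · exact hwirr ⟨-2, by rw [h5]; norm_num⟩
      · norm_num at hp
    obtain ⟨a₀, ha₀⟩ := Function.ne_iff.1 hZv
    have hnb : ∀ b₀, G.Adj a₀ b₀ → (Z ∘ Sum.inl) b₀ ≠ 0 := by
      intro b₀ hadj
      have h1 := adjMatrix_mulVec_of_qMatR_eigen hreg hZeig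
        (qMatR_eigenvalue_ne_zero hreg hZeig hZ0)
      rcases hμ with h2 | h2
      · have h3 : (μ : ℝ) - (r + 1) / μ = -r := by rw [h2]; ring
        rw [h3] at h1
        have h4 := edgeInc_transpose_mulVec_eq_zero hreg h1
        have h5 := edgeInc_transpose_mulVec_apply_of_adj G (Z ∘ Sum.inl) hadj
        rw [h4] at h5
        intro h6
        rw [h6, Pi.zero_apply, add_zero] at h5
        exact ha₀ h5.symm
      · have h3 : (μ : ℝ) - (r + 1) / μ = r := by rw [h2]; ring
        rw [h3] at h1
        rw [eigenvector_const hconn hreg h1 b₀ a₀]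
        exact ha₀
    have hsub : (insert a₀ (G.neighborFinset a₀)).map Function.Embedding.inl ⊆
        ({a, b, c, d} : Finset (V ⊕ G.edgeSet)) := by
      intro i hi
      by_contra hnot
      simp only [Finset.mem_insert, Finset.mem_singleton, not_or] at hnot
      have hZi : Z i = 0 := by
        rw [hZ, Pi.sub_apply, Pi.smul_apply, hx, hy, realPair_apply_of_ne hnot.1 hnot.2.1,
          realPair_apply_of_ne hnot.2.2.1 hnot.2.2.2, smul_zero, sub_zero]
      obtain ⟨k, hk, rfl⟩ := Finset.mem_map.1 hi
      rcases Finset.mem_insert.1 hk with rfl | hk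
      · exact ha₀ hZi
      · exact hnb k ((G.mem_neighborFinset _ _).1 hk) hZi
    have hcard := Finset.card_le_card hsub
    rw [Finset.card_map, Finset.card_insert_of_notMem (G.notMem_neighborFinset_self a₀),
      SimpleGraph.card_neighborFinset_eq_degree, hreg.degree_eq] at hcard
    have := hcard.trans Finset.card_le_four
    omega
  · have hopp : ε (μ - w) = -ε (μ + w) := by
      rcases hε (μ + w) with h1 | h1 <;> rcases hε (μ - w) with h2 | h2
      · exact absurd (h1.trans h2.symm) hsame
      · rw [h1, h2]
      · rw [h1, h2, neg_neg]
      · exact absurd (h1.trans h2.symm) hsame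
    set Y := N *ᵥ y - (μ : ℝ) • y with hY
    set X₁ := N *ᵥ x - (μ : ℝ) • x with hX₁
    set X₂ := N *ᵥ X₁ - (μ : ℝ) • X₁ with hX₂
    have hYq := exists_rat_qMatR_mulVec_sub (G := G) (r := r) μ (hpair c d)
    have hX₂q := exists_rat_qMatR_mulVec_sub (G := G) (r := r) μ
      (exists_rat_qMatR_mulVec_sub (G := G) (r := r) μ (hpair a b))
    have hrel : w • Y - ε (μ + w) • X₂ = 0 := by
      apply eq_zero_of_forall_eigenvector hNs
      intro θ z hz
      rw [dotProduct_sub, dotProduct_smul, dotProduct_smul, hY, hX₂, hdot θ z hz, hdot θ z hz,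
        hX₁, hdot θ z hz, hεz θ z hz, smul_eq_mul, smul_eq_mul]
      by_cases hzx : z ⬝ᵥ x = 0
      · rw [hzx]; ring
      · rcases hcases θ ⟨z, hz, hzx⟩ with rfl | rfl | rfl
        · ring
        · ring
        · rw [hopp]; ring
    have hX₂0 : X₂ ≠ 0 := by
      intro h0
      obtain ⟨z, hz, hzx⟩ := hin₀
      have h1 := hdot ζ₀ z hz X₁
      rw [← hX₂, h0, dotProduct_zero, hX₁, hdot ζ₀ z hz, ← hw] at h1
      exact mul_ne_zero hw0 (mul_ne_zero hw0 hzx) h1.symm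
    obtain ⟨i, hi⟩ := Function.ne_iff.1 hX₂0
    obtain ⟨p₁, hp₁⟩ := hYq i
    obtain ⟨p₂, hp₂⟩ := hX₂q i
    have hp₁' : Y i = p₁ := hp₁
    have hp₂' : X₂ i = p₂ := hp₂
    have h1 := congrFun hrel i
    simp only [Pi.sub_apply, Pi.smul_apply, Pi.zero_apply, smul_eq_mul, hp₁', hp₂'] at h1
    have hp₁0 : p₁ = 0 := by
      rcases hε (μ + w) with h2 | h2
      · exact eq_zero_of_mul_irrational_rat (c := p₂) hwirr (by rw [h2] at h1; linarith)
      · exact eq_zero_of_mul_irrational_rat (c := -p₂) hwirr (by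
          rw [h2] at h1; push_cast; linarith)
    rw [hp₁0] at h1
    apply hi
    rw [hp₂', Pi.zero_apply]
    rcases hε (μ + w) with h2 | h2 <;> rw [h2] at h1 <;> push_cast at h1 <;> linarith

end Cases

/-! ### The three kinds of pair states of the Q-graph -/

section Kinds

variable {V : Type*} [Fintype V] [DecidableEq V] {G : SimpleGraph V} [DecidableRel G.Adj] {r : ℕ}

/-- For every eigenvalue `α` of `G` there are two distinct real numbers `ζ` as in
`qMatR_mulVec_lift`. -/
theorem exists_roots (α : ℝ) (r : ℕ) : ∃ ζ₁ ζ₂ : ℝ, ζ₁ ≠ ζ₂ ∧ ζ₁ ^ 2 = α * ζ₁ + (r + 1) ∧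
    ζ₂ ^ 2 = α * ζ₂ + (r + 1) := by
  have hpos : 0 < α ^ 2 + 4 * ((r : ℝ) + 1) := by positivity
  have hsq := Real.sq_sqrt hpos.le
  have hsp := Real.sqrt_pos.2 hpos
  set t := √(α ^ 2 + 4 * ((r : ℝ) + 1))
  refine ⟨(α + t) / 2, (α - t) / 2, ?_, ?_, ?_⟩
  · intro h
    linarith
  · linear_combination hsq / 4
  · linear_combination hsq / 4

/-- The vertex part of the lifted eigenvector vanishes only for the eigenvalue `-r`. -/
theorem lift_coeff_ne_zero {α ζ : ℝ} (hζ : ζ ^ 2 = α * ζ + (r + 1)) (hα : α ≠ -r) :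
    ζ + 1 - α ≠ 0 := by
  intro h
  apply hα
  have : ζ = α - 1 := by linarith
  rw [this] at hζ
  linarith

/-- A lifted eigenvector for a rational eigenvalue belongs to `α = ± r`. -/
theorem eq_or_eq_neg_of_lift_rational (hreg : G.IsRegularOfDegree r) (hp : (r + 1).Prime)
    {v : V → ℝ} {α ζ : ℝ} (hv : G.adjMatrix ℝ *ᵥ v = α • v) (hv0 : v ≠ 0)
    (hζ : ζ ^ 2 = α * ζ + (r + 1)) (hrat : ∃ q : ℚ, ζ = q) : α = r ∨ α = -r := by
  by_cases hα : α = -r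
  · exact Or.inr hα
  · refine rational_eigenvalue_adj hreg hp (qMatR_mulVec_lift hreg hv hζ) ?_ hrat hζ
    rw [Sum.elim_comp_inl]
    exact smul_ne_zero (lift_coeff_ne_zero hζ hα) hv0

/-- If `ζ` belongs to the eigenvalue `α = ζ - (r + 1) / ζ` of `G`, then so does `-(r + 1) / ζ`. -/
theorem neg_div_root {ζ : ℝ} (hζ : ζ ≠ 0) :
    (-((r : ℝ) + 1) / ζ) ^ 2 = (ζ - (r + 1) / ζ) * (-(r + 1) / ζ) + (r + 1) := by
  field_simp
  ring

/-- There is no transfer from the pair state of two vertices of `G`. -/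
theorem not_transfer_vertex_vertex (hr : 2 ≤ r) (hconn : G.Connected)
    (hreg : G.IsRegularOfDegree r) (hp : (r + 1).Prime) {a b : V} {c d : V ⊕ G.edgeSet}
    (hab : a ≠ b) (hne : s(Sum.inl a, Sum.inl b) ≠ s(c, d)) :
    ¬ HasPairLPSTBetween (qGraph G) (Sum.inl a) (Sum.inl b) c d := by
  intro h
  have hr' : (2 : ℝ) ≤ r := by exact_mod_cast hr
  by_cases hirr : ∃ ζ, Irrational ζ ∧ InSupport (qMatR G r) (realPair (Sum.inl a) (Sum.inl b)) ζ
  · obtain ⟨ζ₀, hζ₀, hin₀⟩ := hirr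
    refine false_of_irrational_of_partner hr hconn hreg hp (Sum.inl_injective.ne hab) hne h ?_
      hζ₀ hin₀
    intro ζ hζ hin
    rw [inSupport_realPair_iff] at hin ⊢
    obtain ⟨z, hz, hzab⟩ := hin
    have hv := adjMatrix_mulVec_of_qMatR_eigen hreg hz hζ.ne_zero
    refine ⟨_, qMatR_mulVec_lift hreg hv (neg_div_root hζ.ne_zero), ?_⟩
    have hcoef : -((r : ℝ) + 1) / ζ + 1 - (ζ - (r + 1) / ζ) ≠ 0 := by
      have h1 : ζ ≠ 1 := hζ.ne_one
      intro h2
      apply h1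
      rw [neg_div] at h2
      linarith
    intro h2
    exact hzab (mul_left_cancel₀ hcoef h2)
  · have hzero : G.adjMatrix ℝ *ᵥ realPair a b + (r : ℝ) • realPair a b = 0 := by
      apply eq_zero_of_forall_eigenvector (SimpleGraph.isSymm_adjMatrix (α := ℝ) G)
      intro α v hv
      rw [dotProduct_add, dotProduct_smul, dotProduct_realPair,
        dotProduct_mulVec_of_eigenvector (SimpleGraph.isSymm_adjMatrix (α := ℝ) G) hv,
        dotProduct_realPair, smul_eq_mul]
      by_cases hvab : v a = v b
      · rw [hvab]; ring
      by_cases hα : α = -r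
      · rw [hα]; ring
      exfalso
      obtain ⟨ζ, -, -, hζ, -⟩ := exists_roots α r
      have hv0 : v ≠ 0 := by
        rintro rfl
        exact hvab rfl
      have hin : InSupport (qMatR G r) (realPair (Sum.inl a) (Sum.inl b)) ζ := by
        rw [inSupport_realPair_iff]
        refine ⟨_, qMatR_mulVec_lift hreg hv hζ, fun h2 => hvab ?_⟩
        exact mul_left_cancel₀ (lift_coeff_ne_zero hζ hα) h2
      have hrat := exists_rat_of_not_irrational fun h1 => hirr ⟨ζ, h1, hin⟩
      rcases eq_or_eq_neg_of_lift_rational hreg hp hv hv0 hζ hrat with h1 | h1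
      · rw [h1] at hv
        exact hvab (eigenvector_const hconn hreg hv a b)
      · exact hα h1
    have h1 := congrFun hzero a
    have h2 : (G.adjMatrix ℝ *ᵥ realPair a b) a = G.adjMatrix ℝ a a - G.adjMatrix ℝ a b :=
      dotProduct_realPair _ _ _
    rw [Pi.add_apply, h2, Pi.smul_apply, SimpleGraph.adjMatrix_apply,
      SimpleGraph.adjMatrix_apply] at h1
    simp only [SimpleGraph.irrefl, if_false, realPair, intPair, Pi.sub_apply, Pi.single_eq_same,
      Pi.single_eq_of_ne hab, smul_eq_mul, Pi.zero_apply] at h1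
    split_ifs at h1 <;> norm_num at h1 <;> linarith

/-- There is no transfer from the pair state of two inserted vertices. -/
theorem not_transfer_edge_edge (hr : 2 ≤ r) (hconn : G.Connected)
    (hreg : G.IsRegularOfDegree r) (hp : (r + 1).Prime) {e f : G.edgeSet} {c d : V ⊕ G.edgeSet}
    (hef : e ≠ f) (hne : s(Sum.inr e, Sum.inr f) ≠ s(c, d)) :
    ¬ HasPairLPSTBetween (qGraph G) (Sum.inr e) (Sum.inr f) c d := by
  intro h
  by_cases hirr : ∃ ζ, Irrational ζ ∧ InSupport (qMatR G r) (realPair (Sum.inr e) (Sum.inr f)) ζ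
  · obtain ⟨ζ₀, hζ₀, hin₀⟩ := hirr
    refine false_of_irrational_of_partner hr hconn hreg hp (Sum.inr_injective.ne hef) hne h ?_
      hζ₀ hin₀
    intro ζ hζ hin
    rw [inSupport_realPair_iff] at hin ⊢
    obtain ⟨z, hz, hzef⟩ := hin
    have hv := adjMatrix_mulVec_of_qMatR_eigen hreg hz hζ.ne_zero
    refine ⟨_, qMatR_mulVec_lift hreg hv (neg_div_root hζ.ne_zero), ?_⟩
    intro h2
    simp only [Sum.elim_inr] at h2
    have h3 := qMatR_eigen_edge hreg hz
    have h4 := congrFun h3 e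
    have h5 := congrFun h3 f
    simp only [Pi.smul_apply, smul_eq_mul, Function.comp_apply] at h4 h5
    rw [h2, h5] at h4
    have hcoef : ζ + ((r : ℝ) + 1) ≠ 0 := by
      intro h6
      exact hζ ⟨-(r + 1), by push_cast; linarith⟩
    exact hzef (mul_left_cancel₀ hcoef h4).symm
  · have hzero : edgeInc G *ᵥ realPair e f = 0 := by
      apply eq_zero_of_forall_eigenvector (SimpleGraph.isSymm_adjMatrix (α := ℝ) G)
      intro α v hv
      rw [dotProduct_edgeInc_mulVec, dotProduct_realPair]
      by_contra hvef
      rw [sub_eq_zero] at hvef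
      have hα : α ≠ -r := by
        rintro rfl
        rw [edgeInc_transpose_mulVec_eq_zero hreg hv] at hvef
        exact hvef rfl
      obtain ⟨ζ, -, -, hζ, -⟩ := exists_roots α r
      have hv0 : v ≠ 0 := by
        rintro rfl
        rw [Matrix.mulVec_zero] at hvef
        exact hvef rfl
      have hin : InSupport (qMatR G r) (realPair (Sum.inr e) (Sum.inr f)) ζ := by
        rw [inSupport_realPair_iff]
        exact ⟨_, qMatR_mulVec_lift hreg hv hζ, hvef⟩
      have hrat := exists_rat_of_not_irrational fun h1 => hirr ⟨ζ, h1, hin⟩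
      rcases eq_or_eq_neg_of_lift_rational hreg hp hv hv0 hζ hrat with h1 | h1
      · rw [h1] at hv
        have hc := eigenvector_const hconn hreg hv
        obtain ⟨a⟩ := hconn.nonempty
        have hconst : ∀ e : G.edgeSet, ((edgeInc G)ᵀ *ᵥ v) e = 2 * v a := by
          intro e
          rw [← sum_edgeInc_col G e, Finset.sum_mul]
          exact Finset.sum_congr rfl fun i _ => by rw [hc i a]; rfl
        exact hvef ((hconst e).trans (hconst f).symm)
      · exact hα h1
    -- Distinct edges have different columns in the incidence matrix.
    have hmem : ∀ a : V, a ∈ (e : Sym2 V) → a ∈ (f : Sym2 V) := by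
      intro a ha
      by_contra hnot
      have h1 := congrFun hzero a
      have h2 : (edgeInc G *ᵥ realPair e f) a = edgeInc G a e - edgeInc G a f :=
        dotProduct_realPair _ _ _
      rw [h2, edgeInc_apply, edgeInc_apply, if_pos ha, if_neg hnot] at h1
      norm_num at h1
    obtain ⟨e, he⟩ := e
    induction e using Sym2.ind with
    | _ a b =>
      apply hef
      apply Subtype.ext
      exact ((Sym2.mem_and_mem_iff (G.ne_of_adj he)).1
        ⟨hmem a (Sym2.mem_mk_left a b), hmem b (Sym2.mem_mk_right a b)⟩).symm

/-- A lift of an eigenvector of `G` that does not vanish at `a` lies in the support of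
`e_a - e_f`, for at least one of the two roots. -/
theorem exists_inSupport_vertex_edge (hreg : G.IsRegularOfDegree r) {a : V} {f : G.edgeSet}
    {v : V → ℝ} {α : ℝ} (hv : G.adjMatrix ℝ *ᵥ v = α • v) (hva : v a ≠ 0) :
    ∃ ζ, ζ ^ 2 = α * ζ + (r + 1) ∧
      InSupport (qMatR G r) (realPair (Sum.inl a) (Sum.inr f)) ζ := by
  obtain ⟨ζ₁, ζ₂, hne, h1, h2⟩ := exists_roots α r
  by_cases hz : (ζ₁ + 1 - α) * v a = ((edgeInc G)ᵀ *ᵥ v) f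
  · refine ⟨ζ₂, h2, (inSupport_realPair_iff _ _ _ _).2 ⟨_, qMatR_mulVec_lift hreg hv h2, ?_⟩⟩
    intro h3
    apply hne
    have := mul_right_cancel₀ hva (hz.trans (show (ζ₂ + 1 - α) * v a = _ from h3).symm)
    linarith
  · exact ⟨ζ₁, h1, (inSupport_realPair_iff _ _ _ _).2 ⟨_, qMatR_mulVec_lift hreg hv h1, hz⟩⟩

/-- Arithmetic of conjugate eigenvalues `-1 ± w` of `qMatR`: `w ^ 2` is an integer `n`, and
`n - 1` divides `(r + 1) ^ 2`. The bound on the eigenvalues of `G` leaves only `n = r + 2`. -/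
theorem sq_eq_of_conj (hr : 2 ≤ r) (hreg : G.IsRegularOfDegree r) (hp : (r + 1).Prime)
    {z₁ z₂ : V ⊕ G.edgeSet → ℝ} {w : ℝ} (hw : Irrational w) (hw2 : ∃ q : ℚ, w ^ 2 = q)
    (h₁ : qMatR G r *ᵥ z₁ = (-1 + w) • z₁) (h₂ : qMatR G r *ᵥ z₂ = (-1 - w) • z₂)
    (hz₁ : z₁ ≠ 0) (hz₂ : z₂ ≠ 0) : w ^ 2 = r + 2 := by
  have hr' : (2 : ℝ) ≤ r := by exact_mod_cast hr
  have hi₁ : Irrational (-1 + w) := by simpa using hw.ratCast_add (-1)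
  have hi₂ : Irrational (-1 - w) := by simpa using hw.ratCast_sub (-1)
  have hv₁ := vertex_ne_zero_of_irrational hreg h₁ hz₁ hi₁
  have hv₂ := vertex_ne_zero_of_irrational hreg h₂ hz₂ hi₂
  have hα₁ := abs_le.1 (abs_eigenvalue_le hreg
    (adjMatrix_mulVec_of_qMatR_eigen hreg h₁ hi₁.ne_zero) hv₁)
  have hα₂ := abs_le.1 (abs_eigenvalue_le hreg
    (adjMatrix_mulVec_of_qMatR_eigen hreg h₂ hi₂.ne_zero) hv₂)
  obtain ⟨hI₁, hJ₁⟩ := isIntegral_add_one_div hreg h₁ hv₁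
  obtain ⟨hI₂, hJ₂⟩ := isIntegral_add_one_div hreg h₂ hv₂
  obtain ⟨q, hq⟩ := hw2
  have hwi : IsIntegral ℤ (w ^ 2) := by
    have h := (hI₁.add isIntegral_one).pow 2
    rwa [neg_add_eq_sub, sub_add_cancel] at h
  rw [hq] at hwi
  obtain ⟨n, rfl⟩ := exists_int_of_isIntegral hwi
  have hwn : w ^ 2 = n := by rw [hq]; simp
  have hprod : (-1 + w) * (-1 - w) = 1 - n := by
    rw [← hwn]
    ring
  have hN0 : (1 - n : ℝ) ≠ 0 := by
    rw [← hprod]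
    exact mul_ne_zero hi₁.ne_zero hi₂.ne_zero
  have hJ := hJ₁.mul hJ₂
  rw [div_mul_div_comm, hprod] at hJ
  have hJ' : ((r : ℝ) + 1) * (r + 1) / (1 - n) = (((r + 1) * (r + 1) / (1 - n) : ℚ) : ℝ) := by
    push_cast
    ring
  rw [hJ'] at hJ
  obtain ⟨m, hm⟩ := exists_int_of_isIntegral hJ
  have hN0q : (1 - n : ℚ) ≠ 0 := by exact_mod_cast hN0
  rw [div_eq_iff hN0q] at hm
  have hmn : ((r : ℤ) + 1) * (r + 1) = m * (1 - n) := by exact_mod_cast hm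
  have hn2 : 2 ≤ n := by
    have h0 : (0 : ℝ) < n := by
      rw [← hwn]
      have := hw.ne_zero
      positivity
    have h0' : 0 < n := by exact_mod_cast h0
    have h1 : n ≠ 1 := by
      rintro rfl
      simp at hN0
    omega
  obtain ⟨k, hk⟩ := Int.eq_ofNat_of_zero_le (by omega : 0 ≤ n - 1)
  have hkd : k ∣ (r + 1) ^ 2 := by
    have : (k : ℤ) ∣ (((r + 1) ^ 2 : ℕ) : ℤ) := ⟨-m, by
      push_cast
      rw [← hk, sq, hmn]
      ring⟩
    exact_mod_cast this
  obtain ⟨i, hi, rfl⟩ := (Nat.dvd_prime_pow hp).1 hkd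
  have hnk : (n : ℝ) = 1 + (r + 1) ^ i := by
    have : n = 1 + ((r + 1) ^ i : ℕ) := by omega
    rw [this]
    push_cast
    ring
  -- The two eigenvalues of `G` to which `-1 + w` and `-1 - w` belong.
  have e₁ : (-1 + w) - (r + 1) / (-1 + w) = (-1 + w) - (r + 1) * (-1 - w) / (1 - n) := by
    rw [← hprod]
    have := hi₁.ne_zero
    have := hi₂.ne_zero
    field_simp
  have e₂ : (-1 - w) - (r + 1) / (-1 - w) = (-1 - w) - (r + 1) * (-1 + w) / (1 - n) := by
    rw [← hprod]
    have := hi₁.ne_zero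
    have := hi₂.ne_zero
    field_simp
  rw [e₁] at hα₁
  rw [e₂] at hα₂
  have h1n : (1 : ℝ) - n = -(r + 1) ^ i := by rw [hnk]; ring
  rw [h1n] at hα₁ hα₂
  interval_cases i
  · exfalso
    simp only [pow_zero, div_neg, div_one] at hα₁ hα₂
    linarith
  · rw [hwn, hnk]
    ring
  · exfalso
    have hr1 : (0 : ℝ) < r + 1 := by positivity
    have e₃ : (r + 1) * (-1 - w) / -((r : ℝ) + 1) ^ 2 = (1 + w) / (r + 1) := by
      field_simp
      ring
    have e₄ : (r + 1) * (-1 + w) / -((r : ℝ) + 1) ^ 2 = (1 - w) / (r + 1) := by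
      field_simp
      ring
    rw [e₃] at hα₁
    rw [e₄] at hα₂
    have hdiff : 2 * w * r / (r + 1) = ((-1 + w) - (1 + w) / (r + 1))
        - ((-1 - w) - (1 - w) / (r + 1)) := by
      field_simp
      ring
    have hle : |2 * w * r / (r + 1)| ≤ 2 * r := by
      rw [hdiff, abs_le]
      constructor <;> linarith [hα₁.1, hα₁.2, hα₂.1, hα₂.2]
    have hle2 : |w| ≤ r + 1 := by
      rw [abs_div, abs_mul, abs_mul, abs_of_pos hr1, abs_of_pos (by norm_num : (0 : ℝ) < 2),
        abs_of_nonneg (by linarith : (0 : ℝ) ≤ r), div_le_iff₀ hr1] at hle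
      nlinarith
    have hsq := sq_le_sq' (by linarith [abs_nonneg w]) hle2
    rw [sq_abs, hwn, hnk] at hsq
    linarith

/-- There is no transfer from the pair state of a vertex of `G` and an inserted vertex. Here the
eigenvalue `-1` always lies in the support. -/
theorem not_transfer_vertex_edge (hr : 2 ≤ r) (hreg : G.IsRegularOfDegree r) (hp : (r + 1).Prime)
    {a : V} {f : G.edgeSet} {c d : V ⊕ G.edgeSet} (hne : s(Sum.inl a, Sum.inr f) ≠ s(c, d)) :
    ¬ HasPairLPSTBetween (qGraph G) (Sum.inl a) (Sum.inr f) c d := by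
  intro h
  obtain ⟨-, μ, s, D, hD, hform⟩ := exists_sign_and_form Sum.inl_ne_inr hne h r
  have hr' : (2 : ℝ) ≤ r := by exact_mod_cast hr
  have hA := SimpleGraph.isSymm_adjMatrix (α := ℝ) G
  set A := G.adjMatrix ℝ with hAdef
  set δ : V → ℝ := Pi.single a 1 with hδ
  have hdot : ∀ v : V → ℝ, v ⬝ᵥ δ = v a := by
    intro v
    rw [hδ, dotProduct_single, mul_one]
  have hAδ : (A *ᵥ δ) a = 0 := by
    rw [hδ, Matrix.mulVec_single_one]
    simp [hAdef]
  have hAAδ : (A *ᵥ (A *ᵥ δ)) a = r := by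
    rw [Matrix.mulVec_mulVec, hδ, Matrix.mulVec_single_one, Matrix.col_apply, hAdef,
      SimpleGraph.adjMatrix_mul_self_apply_self, hreg.degree_eq]
  have hδa : δ a = 1 := by simp [hδ]
  by_cases hirr : ∃ ζ, Irrational ζ ∧ InSupport (qMatR G r) (realPair (Sum.inl a) (Sum.inr f)) ζ
  · obtain ⟨ζ₀, hζ₀, hin₀⟩ := hirr
    have hs : Irrational s := by
      by_contra hs
      obtain ⟨t, rfl⟩ := exists_rat_of_not_irrational hs
      obtain ⟨q, hq, -⟩ := hform _ hin₀
      exact hζ₀ ⟨μ + q * t, by rw [hq]; push_cast; ring⟩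
    have hratμ : ∀ t : ℚ, InSupport (qMatR G r) (realPair (Sum.inl a) (Sum.inr f)) (t : ℝ) →
        (t : ℝ) = μ := by
      intro t ht
      obtain ⟨q, hq, -⟩ := hform _ ht
      have : q = 0 := eq_zero_of_mul_irrational_rat (c := t - μ) hs (by push_cast; linarith)
      rw [hq, this]
      simp
    have hμ : (μ : ℝ) = -1 := by
      have hone : G.adjMatrix ℝ *ᵥ (fun _ => 1) = (r : ℝ) • (fun _ : V => (1 : ℝ)) := by
        ext i
        rw [SimpleGraph.adjMatrix_mulVec_apply]
        simp [hreg.degree_eq]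
      have hm1 : InSupport (qMatR G r) (realPair (Sum.inl a) (Sum.inr f)) ((-1 : ℚ) : ℝ) := by
        rw [inSupport_realPair_iff]
        refine ⟨_, qMatR_mulVec_lift hreg hone (by push_cast; ring), ?_⟩
        have h2 : ((edgeInc G)ᵀ *ᵥ fun _ => (1 : ℝ)) f = 2 := by
          rw [← sum_edgeInc_col G f]
          simp [Matrix.mulVec, dotProduct]
        rw [Sum.elim_inl, Sum.elim_inr, h2, Pi.smul_apply]
        push_cast
        rw [smul_eq_mul]
        intro h3
        linarith
      have := hratμ (-1) hm1
      rw [← this]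
      simp
    have hquad : ∀ ζ, Irrational ζ →
        InSupport (qMatR G r) (realPair (Sum.inl a) (Sum.inr f)) ζ → ζ ^ 2 = -2 * ζ + (r + 1) := by
      intro ζ hζ hin
      obtain ⟨q, hq, hconj⟩ := hform _ hin
      obtain ⟨z₂, hz₂, hzx₂⟩ := hconj hs
      obtain ⟨z₁, hz₁, hzx₁⟩ := hin
      rw [hμ] at hq hz₂
      have hw : Irrational ((q : ℝ) * s) := by
        have h1 : (q : ℝ) * s = ζ + ((1 : ℚ) : ℝ) := by
          rw [hq]
          push_cast
          ring
        rw [h1]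
        exact hζ.add_ratCast 1
      have h1 := sq_eq_of_conj hr hreg hp hw ⟨q ^ 2 * D, by push_cast; rw [mul_pow, hD]⟩
        (hq ▸ hz₁) hz₂ (by rintro rfl; simp at hzx₁) (by rintro rfl; simp at hzx₂)
      rw [hq]
      linear_combination h1
    -- Only the eigenvalues `r` and `-2` of `G` contribute to `δ`.
    have hzero : A *ᵥ (A *ᵥ δ) + (2 - (r : ℝ)) • (A *ᵥ δ) - (2 * (r : ℝ)) • δ = 0 := by
      apply eq_zero_of_forall_eigenvector hA
      intro α v hv
      rw [dotProduct_sub, dotProduct_add, dotProduct_smul, dotProduct_smul,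
        dotProduct_mulVec_of_eigenvector hA hv, dotProduct_mulVec_of_eigenvector hA hv, hdot,
        smul_eq_mul, smul_eq_mul]
      have hfac : α * (α * v a) + (2 - r) * (α * v a) - 2 * r * v a =
          (α - r) * (α + 2) * v a := by ring
      rw [hfac]
      by_contra hprod
      have hva : v a ≠ 0 := right_ne_zero_of_mul hprod
      have hαr : α ≠ r := by
        rintro rfl
        simp at hprod
      have hα2 : α ≠ -2 := by
        rintro rfl
        simp at hprod
      obtain ⟨ζ, hζ, hin⟩ := exists_inSupport_vertex_edge (f := f) hreg hv hva
      by_cases hi : Irrational ζ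
      · apply hα2
        apply mul_right_cancel₀ hi.ne_zero
        linarith [hquad ζ hi hin]
      · have hv0 : v ≠ 0 := by
          rintro rfl
          exact hva rfl
        have hα := (eq_or_eq_neg_of_lift_rational hreg hp hv hv0 hζ
          (exists_rat_of_not_irrational hi)).resolve_left hαr
        rw [hα] at hv
        have h1 : InSupport (qMatR G r) (realPair (Sum.inl a) (Sum.inr f)) ((1 : ℚ) : ℝ) := by
          rw [inSupport_realPair_iff]
          have h2 := qMatR_mulVec_lift (ζ := 1) hreg hv (by ring)
          rw [edgeInc_transpose_mulVec_eq_zero hreg hv] at h2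
          refine ⟨_, by simpa using h2, ?_⟩
          simp only [Sum.elim_inl, Sum.elim_inr, Pi.smul_apply, Pi.zero_apply, smul_eq_mul]
          exact mul_ne_zero (by linarith) hva
        have := hratμ 1 h1
        rw [hμ] at this
        norm_num at this
    have h1 := congrFun hzero a
    simp only [Pi.sub_apply, Pi.add_apply, Pi.smul_apply, hAδ, hAAδ, hδa, smul_eq_mul,
      Pi.zero_apply] at h1
    linarith
  · -- Only the eigenvalues `± r` of `G` contribute to `δ`.
    have hzero : A *ᵥ (A *ᵥ δ) - ((r : ℝ) ^ 2) • δ = 0 := by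
      apply eq_zero_of_forall_eigenvector hA
      intro α v hv
      rw [dotProduct_sub, dotProduct_smul, dotProduct_mulVec_of_eigenvector hA hv,
        dotProduct_mulVec_of_eigenvector hA hv, hdot, smul_eq_mul]
      by_cases hva : v a = 0
      · rw [hva]; ring
      obtain ⟨ζ, hζ, hin⟩ := exists_inSupport_vertex_edge (f := f) hreg hv hva
      have hrat := exists_rat_of_not_irrational fun h1 => hirr ⟨ζ, h1, hin⟩
      have hv0 : v ≠ 0 := by
        rintro rfl
        exact hva rfl
      rcases eq_or_eq_neg_of_lift_rational hreg hp hv hv0 hζ hrat with h1 | h1 <;> rw [h1] <;> ring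
    have h1 := congrFun hzero a
    simp only [Pi.sub_apply, Pi.smul_apply, hAAδ, hδa, smul_eq_mul, Pi.zero_apply] at h1
    nlinarith

end Kinds

theorem pairState_swap {W : Type*} [DecidableEq W] (a b : W) : pairState b a = -pairState a b := by
  rw [pairState, pairState, neg_sub]

theorem HasPairLPSTBetween.swap {W : Type*} [Fintype W] [DecidableEq W] {H : SimpleGraph W}
    [DecidableRel H.Adj] {a b c d : W} (h : HasPairLPSTBetween H a b c d) :
    HasPairLPSTBetween H b a d c := by
  obtain ⟨τ, χ, hχ, h⟩ := h
  refine ⟨τ, χ, hχ, ?_⟩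
  rw [pairState_swap a b, pairState_swap c d, Matrix.mulVec_neg, h, smul_neg]

theorem theorem3p2 {V : Type*} [Fintype V] [DecidableEq V] (G : SimpleGraph V)
    [DecidableRel G.Adj] (r : ℕ) (hr : 2 ≤ r) (hconn : G.Connected)
    (hreg : G.IsRegularOfDegree r) (hprime : (r + 1).Prime)
    (a b c d : V ⊕ G.edgeSet) (hab : a ≠ b) (hcd : c ≠ d) (hdistinct : s(a, b) ≠ s(c, d)) :
    ¬ HasPairLPSTBetween (qGraph G) a b c d := by
  rcases a with a | e <;> rcases b with b | f
  · exact not_transfer_vertex_vertex hr hconn hreg hprime (fun h => hab (congrArg _ h)) hdistinct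
  · exact not_transfer_vertex_edge hr hreg hprime hdistinct
  · intro h
    refine not_transfer_vertex_edge hr hreg hprime ?_ h.swap
    rwa [Sym2.eq_swap, Sym2.eq_swap (a := d)]
  · exact not_transfer_edge_edge hr hconn hreg hprime (fun h => hab (congrArg _ h)) hdistinct
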